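/- For $n\ge 1$, the Sierpiński graph $S_3^n$ has vertex set $\{0,1,2\}^n$, two vertices $i_1\cdots i_n$ and $j_1\cdots j_n$ being adjacent if there is an index $h\in\{1,\dots,n\}$ such that $i_t=j_t$ for all $t<h$, $i_h\ne j_h$, and $i_t=j_h$ and $j_t=i_h$ for all $t>h$. For $n\ge 2$ and $i\in\{0,1,2\}$, let $V(iS_3^{n-1})$ denote the set of vertices of $S_3^n$ whose first coordinate is $i$. A set $X$ of vertices of a finite graph $G$ is a mutual-visibility set if for any $u,v\in X$ there is a shortest $u,v$-path $P$ with $V(P)\cap X\subseteq\{u,v\}$. The mutual-visibility number $\mu(G)$ is the largest cardinality of a mutual-visibility set of $G$, and a $\mu$-set of $G$ is a mutual-visibility set of cardinality $\mu(G)$. Theorem. If $n\ge 2$, then $\mu(S_3^n)=3^{n-2}+3$. Moreover, if $n\ge 4$ and $X$ is a $\mu$-set of $S_3^n$, then $|X\cap V(iS_3^{n-1})|=3^{n-3}+1$ for every $i\in\{0,1,2\}$. In addition, if $n\ge 4$ and $X$ is a mutual-visibility set of $S_3^n$, then $|X\cap (V(iS_3^{n-1})\cup V(jS_3^{n-1}))|\le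 2\cdot 3^{n-3}+4$ for all $i,j\in\{0,1,2\}$. -/

import Mathlib

/-- The Sierpiński graph `S_p^n`: vertices are the words of length `n` over `{0, …, p - 1}`
(the letter at position `0` is the first one), and `u`, `v` are adjacent iff for some position `h`
they agree before `h`, differ at `h`, and after `h` the word `u` is constantly `v h`
and the word `v` is constantly `u h`. -/
def sierpinskiGraph (p n : ℕ) : SimpleGraph (Fin n → Fin p) where
  Adj u v := ∃ h : Fin n, (∀ t, t < h → u t = v t) ∧ u h ≠ v h ∧
    ∀ t, h < t → u t = v h ∧ v t = u h
  symm := ⟨fun _ _ ⟨h, h1, h2, h3⟩ =>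
    ⟨h, fun t ht => (h1 t ht).symm, h2.symm, fun t ht => (h3 t ht).symm⟩⟩
  loopless := ⟨fun _ ⟨_, _, h2, _⟩ => h2 rfl⟩

/-- The vertex set of the copy `iS_p^{n-1}` in `S_p^n`: the words whose first letter is `i`. -/
def sierpinskiCopy (p n : ℕ) (i : Fin p) : Finset (Fin n → Fin p) :=
  Finset.univ.filter fun v => ∃ h : 0 < n, v ⟨0, h⟩ = i

namespace SimpleGraph

variable {V : Type*}

/-- `u` and `v` are `X`-visible: some shortest `u,v`-path meets `X` at most in its ends. -/
def XVisible (G : SimpleGraph V) (X : Set V) (u v : V) : Prop :=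
  ∃ P : G.Walk u v, P.IsPath ∧ P.length = G.dist u v ∧ {w | w ∈ P.support} ∩ X ⊆ {u, v}

/-- Any two vertices of `X` are `X`-visible. -/
def IsMutualVisibilitySet (G : SimpleGraph V) (X : Finset V) : Prop :=
  ∀ u ∈ X, ∀ v ∈ X, G.XVisible (X : Set V) u v

/-- The mutual-visibility number `μ(G)` of a finite graph: the largest cardinality of a
mutual-visibility set. -/
noncomputable def mutualVisibilityNumber [Finite V] (G : SimpleGraph V) : ℕ :=
  sSup {k | ∃ X : Finset V, G.IsMutualVisibilitySet X ∧ X.card = k}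

/-- A `μ`-set: a mutual-visibility set of cardinality `μ(G)`. -/
def IsMuSet [Finite V] (G : SimpleGraph V) (X : Finset V) : Prop :=
  G.IsMutualVisibilitySet X ∧ X.card = G.mutualVisibilityNumber

end SimpleGraph

-- Shortest paths in the graph are rigid. Between words of one copy they stay in that copy. The
-- shortest path to a corner `c…c` is unique. Between copies `a` and `b`, a shortest path either
-- uses the edge joining them or detours through the third copy `k` along its whole side, the words
-- over `{a, b}`. Visibility thus becomes a recursive condition on words: `Vis` is built from `Sees`
-- (clear path to a corner) and `Free` (unoccupied side). `xVisible_iff` identifies it with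
-- visibility in the graph, so the counting never mentions walks.
--
-- The upper bound is an induction on the word length `j + 2` with a strengthened claim: a set whose
-- words all see zero, one or two given corners has at most `3 ^ j + 3`, `3 ^ j + 2` or `3 ^ j + 1`
-- words, and at most `3 ^ j` if it sees all three and two sides are free. The engine is
-- `direct_or_blocked`. Either all words of two copies see the joining edge, or some word of copy
-- `a` does not see copy `b`. In the latter case every word of copy `b` is reached by the detour
-- through `k`, so it sees `k…k` and lies nearer to `k…k` than to `a…a`. Such nearness empties a
-- third of that copy, and `Bounds.pair` and `Bounds.triple` turn this into a saving.
--
-- If all copies are nonempty and pairwise direct, each sees two corners, which gives `3 * (3 ^ j +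
-- 1)` for length `j + 3`, with equality only for an even split. From length four on, every other
-- configuration is strictly smaller (`Bounds.succ_any`). The savings from nearness reach full
-- strength only for `j ≥ 2`; length two is checked exhaustively and length three by separate
-- arguments.
--
-- For length at least three the bound is attained by the words ending in `012`, `120` or `201`
-- together with the three corners (`coreWith_visible`).

/-- Words of length `n` over the alphabet `Fin 3`, as nested pairs. -/
abbrev Word : ℕ → Type
  | 0 => Unit
  | n + 1 => Fin 3 × Word n

instance Word.fintype : ∀ n, Fintype (Word n)
  | 0 => inferInstanceAs (Fintype Unit)
  | n + 1 => @instFintypeProd (Fin 3) (Word n) _ (Word.fintype n)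

instance Word.decidableEq : ∀ n, DecidableEq (Word n)
  | 0 => inferInstanceAs (DecidableEq Unit)
  | n + 1 => @instDecidableEqProd (Fin 3) (Word n) _ (Word.decidableEq n)

/-- Sets of words, as Boolean-valued functions. -/
abbrev WordSet (n : ℕ) : Type := Word n → Bool

namespace WordSet

variable {n : ℕ}

/-- The words of `X` with first letter `a`, with that letter removed. -/
def sub (X : WordSet (n + 1)) (a : Fin 3) : WordSet n := fun u => X (a, u)

/-- The number of words in `X`. -/
def cnt : ∀ {n}, WordSet n → ℕ
  | 0, X => (X ()).toNat
  | _ + 1, X => cnt (sub X 0) + cnt (sub X 1) + cnt (sub X 2)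

/-- No word of `X` has all its letters in `{a, b}`. -/
def Free (a b : Fin 3) : ∀ {n}, WordSet n → Prop
  | 0, X => X () = false
  | _ + 1, X => Free a b (sub X a) ∧ Free a b (sub X b)

/-- The distance from `u` to the extreme vertex `c…c`. -/
def dc (c : Fin 3) : ∀ {n}, Word n → ℕ
  | 0, _ => 0
  | n + 1, u => (if u.1 = c then 0 else 2 ^ n) + dc c (n := n) u.2

/-- The shortest path from `u` to the extreme vertex `c…c` meets `X` at most in `u`. -/
def Sees (c : Fin 3) : ∀ {n}, WordSet n → Word n → Prop
  | 0, _, _ => True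
  | n + 1, X, u => Sees c (n := n) (sub X u.1) u.2 ∧ (u.1 = c ∨ Free u.1 c (sub X c))

/-- The letter different from two given different letters. -/
def third (a b : Fin 3) : Fin 3 := -(a + b)

/-- Some shortest path between `u` and `v` meets `X` at most in its ends. -/
def Vis : ∀ {n}, WordSet n → Word n → Word n → Prop
  | 0, _, _, _ => True
  | n + 1, X, u, v =>
    if u.1 = v.1 then Vis (n := n) (sub X u.1) u.2 v.2 else
      (dc (n := n) v.1 u.2 + dc (n := n) u.1 v.2 ≤
          dc (n := n) (third u.1 v.1) u.2 + 2 ^ n + dc (n := n) (third u.1 v.1) v.2 ∧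
        Sees v.1 (n := n) (sub X u.1) u.2 ∧ Sees u.1 (n := n) (sub X v.1) v.2) ∨
      (dc (n := n) (third u.1 v.1) u.2 + 2 ^ n + dc (n := n) (third u.1 v.1) v.2 ≤
          dc (n := n) v.1 u.2 + dc (n := n) u.1 v.2 ∧
        Sees (third u.1 v.1) (n := n) (sub X u.1) u.2 ∧
        Sees (third u.1 v.1) (n := n) (sub X v.1) v.2 ∧
        Free u.1 v.1 (sub X (third u.1 v.1)))

/-- Mutual visibility of a set of words. -/
def MV (X : WordSet n) : Prop := ∀ u v, X u = true → X v = true → Vis X u v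

/-- All words of `X` see the extreme vertex `c…c`. -/
def All (c : Fin 3) (X : WordSet n) : Prop := ∀ u, X u = true → Sees c X u

instance Free.decidable (a b : Fin 3) : ∀ {n} (X : WordSet n), Decidable (Free a b X)
  | 0, X => inferInstanceAs (Decidable (X () = false))
  | _ + 1, X => @instDecidableAnd _ _ (Free.decidable a b (sub X a)) (Free.decidable a b (sub X b))

instance Sees.decidable (c : Fin 3) : ∀ {n} (X : WordSet n) (u : Word n), Decidable (Sees c X u)
  | 0, _, _ => inferInstanceAs (Decidable True)
  | n + 1, X, u =>
    haveI := Sees.decidable c (n := n) (sub X u.1) u.2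
    inferInstanceAs (Decidable (Sees c (n := n) (sub X u.1) u.2 ∧
      (u.1 = c ∨ Free u.1 c (sub X c))))

instance Vis.decidable : ∀ {n} (X : WordSet n) (u v : Word n), Decidable (Vis X u v)
  | 0, _, _, _ => inferInstanceAs (Decidable True)
  | n + 1, X, u, v => by
    haveI := Vis.decidable (n := n) (sub X u.1) u.2 v.2
    unfold Vis
    infer_instance

instance (X : WordSet n) : Decidable (MV X) := by unfold MV; infer_instance

instance (c : Fin 3) (X : WordSet n) : Decidable (All c X) := by unfold All; infer_instance

end WordSet

-- Length two: exhaustive checks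

namespace WordSet

/-- The set of words of length two given by its nine membership values. -/
def ofBools (b₀ b₁ b₂ b₃ b₄ b₅ b₆ b₇ b₈ : Bool) : WordSet 2 := fun u =>
  match u.1, u.2.1 with
  | 0, 0 => b₀ | 0, 1 => b₁ | 0, 2 => b₂
  | 1, 0 => b₃ | 1, 1 => b₄ | 1, 2 => b₅
  | 2, 0 => b₆ | 2, 1 => b₇ | 2, 2 => b₈

/-- Nine Boolean quantifiers replace one over functions, so the kernel can decide a claim about
length two by running through 512 sets. -/
theorem forall_wordSet_two {P : WordSet 2 → Prop}
    (h : ∀ b₀ b₁ b₂ b₃ b₄ b₅ b₆ b₇ b₈, P (ofBools b₀ b₁ b₂ b₃ b₄ b₅ b₆ b₇ b₈)) (X : WordSet 2) :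
    P X := by
  convert h (X (0, 0, ())) (X (0, 1, ())) (X (0, 2, ())) (X (1, 0, ())) (X (1, 1, ()))
    (X (1, 2, ())) (X (2, 0, ())) (X (2, 1, ())) (X (2, 2, ()))
  funext ⟨i, j, _⟩
  fin_cases i <;> fin_cases j <;> rfl

theorem cnt_two_le (X : WordSet 2) : MV X → cnt X ≤ 4 :=
  forall_wordSet_two (P := fun X => MV X → cnt X ≤ 4) (by decide +kernel) X

theorem cnt_two_le_of_all (X : WordSet 2) : ∀ c, All c X → MV X → cnt X ≤ 3 :=
  forall_wordSet_two (P := fun X => ∀ c, All c X → MV X → cnt X ≤ 3) (by decide +kernel) X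

theorem cnt_two_le_of_all_all (X : WordSet 2) :
    ∀ c d, c ≠ d → All c X → All d X → MV X → cnt X ≤ 2 :=
  forall_wordSet_two (P := fun X => ∀ c d, c ≠ d → All c X → All d X → MV X → cnt X ≤ 2)
    (by decide +kernel) X

theorem cnt_two_le_of_all_all_free (X : WordSet 2) : ∀ c p q, c ≠ p → c ≠ q → p ≠ q →
    Free c p X → Free c q X → All c X → All q X → cnt X ≤ 1 :=
  forall_wordSet_two (P := fun X => ∀ c p q, c ≠ p → c ≠ q → p ≠ q →
    Free c p X → Free c q X → All c X → All q X → cnt X ≤ 1) (by decide +kernel) X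

/-- Every word of `X` is nearer to the extreme vertex `k…k` than to `a…a`, by at least `t`. -/
def Near (k a : Fin 3) (t : ℕ) {n : ℕ} (X : WordSet n) : Prop :=
  ∀ u, X u = true → dc k u + t ≤ dc a u

instance (k a : Fin 3) (t : ℕ) {n : ℕ} (X : WordSet n) : Decidable (Near k a t X) := by
  unfold Near; infer_instance

theorem cnt_two_le_of_near_zero (X : WordSet 2) : ∀ k a, k ≠ a → All k X → Near k a 0 X →
    cnt X ≤ 2 :=
  forall_wordSet_two (P := fun X => ∀ k a, k ≠ a → All k X → Near k a 0 X → cnt X ≤ 2)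
    (by decide +kernel) X

theorem cnt_two_le_of_near_two (X : WordSet 2) : ∀ k a, k ≠ a → All k X → Near k a 2 X →
    cnt X ≤ 1 :=
  forall_wordSet_two (P := fun X => ∀ k a, k ≠ a → All k X → Near k a 2 X → cnt X ≤ 1)
    (by decide +kernel) X

theorem cnt_two_le_of_near_three (X : WordSet 2) : ∀ k a, k ≠ a → Near k a 3 X → cnt X ≤ 1 :=
  forall_wordSet_two (P := fun X => ∀ k a, k ≠ a → Near k a 3 X → cnt X ≤ 1)
    (by decide +kernel) X

theorem cnt_two_le_of_all_free (X : WordSet 2) : ∀ k b, k ≠ b → Free k b X → All k X → MV X →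
    cnt X ≤ 2 :=
  forall_wordSet_two (P := fun X => ∀ k b, k ≠ b → Free k b X → All k X → MV X → cnt X ≤ 2)
    (by decide +kernel) X

/-- Serves the case `j = 0` of `Bounds.pair`, where a word blind to `b…b` is nearer to `k…k` because
the detour is not longer than the direct path. -/
theorem cnt_two_le_of_blind_near (X : WordSet 2) : ∀ k b, k ≠ b → All k X → MV X → ¬ All b X →
    (∀ u, X u = true → ¬ Sees b X u → dc k u + 1 ≤ dc b u) → cnt X ≤ 2 :=
  forall_wordSet_two (P := fun X => ∀ k b, k ≠ b → All k X → MV X → ¬ All b X →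
    (∀ u, X u = true → ¬ Sees b X u → dc k u + 1 ≤ dc b u) → cnt X ≤ 2) (by decide +kernel) X

theorem cnt_two_le_of_free_near_zero (X : WordSet 2) : ∀ k b, k ≠ b → Free b k X →
    Near k b 0 X → All k X → cnt X ≤ 1 :=
  forall_wordSet_two (P := fun X => ∀ k b, k ≠ b → Free b k X → Near k b 0 X → All k X →
    cnt X ≤ 1) (by decide +kernel) X

theorem cnt_two_le_of_free_near_one (X : WordSet 2) : ∀ k b c, k ≠ b → k ≠ c → b ≠ c →
    Free c k X → Near k b 1 X → All k X → cnt X ≤ 1 :=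
  forall_wordSet_two (P := fun X => ∀ k b c, k ≠ b → k ≠ c → b ≠ c → Free c k X → Near k b 1 X →
    All k X → cnt X ≤ 1) (by decide +kernel) X

theorem cnt_two_le_of_all_near_one (X : WordSet 2) : ∀ a b k, a ≠ b → k ≠ a → k ≠ b →
    Near a k 1 X → All a X → All b X → All k X → cnt X ≤ 1 :=
  forall_wordSet_two (P := fun X => ∀ a b k, a ≠ b → k ≠ a → k ≠ b → Near a k 1 X →
    All a X → All b X → All k X → cnt X ≤ 1) (by decide +kernel) X

theorem sees_of_free_of_le (X : WordSet 2) : ∀ a b k, a ≠ b → k ≠ a → k ≠ b →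
    Free a k X → All k X → ∀ u, X u = true → dc k u ≤ dc b u → Sees b X u :=
  forall_wordSet_two (P := fun X => ∀ a b k, a ≠ b → k ≠ a → k ≠ b →
    Free a k X → All k X → ∀ u, X u = true → dc k u ≤ dc b u → Sees b X u) (by decide +kernel) X

theorem dc_lt_of_free_free (X : WordSet 2) : ∀ a b k, a ≠ b → k ≠ a → k ≠ b →
    Free a k X → Free b k X → ∀ u, X u = true → dc b u < dc k u :=
  forall_wordSet_two (P := fun X => ∀ a b k, a ≠ b → k ≠ a → k ≠ b →
    Free a k X → Free b k X → ∀ u, X u = true → dc b u < dc k u) (by decide +kernel) X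

end WordSet

-- Free sides, seen corners, and the direct-or-blocked dichotomy

namespace WordSet

variable {n : ℕ}

/-- `X` has a word. -/
def Nonempty (X : WordSet n) : Prop := ∃ u, X u = true

theorem not_nonempty_iff {X : WordSet n} : ¬ X.Nonempty ↔ ∀ u, X u = false := by
  simp [Nonempty]

theorem dc_lt (c : Fin 3) : ∀ {n} (u : Word n), dc c u + 1 ≤ 2 ^ n
  | 0, _ => by simp [dc]
  | n + 1, u => by
    have := dc_lt c (n := n) u.2
    simp only [dc, pow_succ]
    split_ifs <;> omega

@[simp] theorem dc_cons (c a : Fin 3) (u : Word n) :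
    dc c (n := n + 1) (a, u) = (if a = c then 0 else 2 ^ n) + dc c u := rfl

theorem eq_of_dc_eq_zero {c : Fin 3} : ∀ {n} {u v : Word n}, dc c u = 0 → dc c v = 0 → u = v
  | 0, _, _, _, _ => rfl
  | n + 1, (a, u), (b, v), hu, hv => by
    simp only [dc_cons, Nat.add_eq_zero_iff, ite_eq_left_iff, Nat.pow_eq_zero] at hu hv
    have ha : a = c := by by_contra h; simpa using hu.1 h
    have hb : b = c := by by_contra h; simpa using hv.1 h
    rw [ha, hb, eq_of_dc_eq_zero hu.2 hv.2]

theorem cnt_eq_zero : ∀ {n} {X : WordSet n}, (∀ u, X u = false) → cnt X = 0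
  | 0, X, h => by simp [cnt, h]
  | n + 1, X, h => by
    simp [cnt, cnt_eq_zero (X := sub X _) fun u => h (_, u)]

theorem cnt_mono : ∀ {n} {X Y : WordSet n}, (∀ u, X u = true → Y u = true) → cnt X ≤ cnt Y
  | 0, X, Y, h => by
    have := h ()
    cases hX : X () <;> simp_all [cnt]
  | n + 1, X, Y, h => by
    have := fun a => cnt_mono (X := sub X a) (Y := sub Y a) fun u hu => h (a, u) hu
    simp only [cnt]
    have h0 := this 0
    have h1 := this 1
    have h2 := this 2
    omega

theorem cnt_le_one : ∀ {n} {X : WordSet n}, (∀ u v, X u = true → X v = true → u = v) → cnt X ≤ 1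
  | 0, X, _ => by cases h : X () <;> simp [cnt, h]
  | n + 1, X, h => by
    have hs : ∀ a, cnt (sub X a) ≤ 1 := fun a =>
      cnt_le_one fun u v hu hv => (Prod.ext_iff.1 (h (a, u) (a, v) hu hv)).2
    have hz : ∀ a b, a ≠ b → 0 < cnt (sub X a) → cnt (sub X b) = 0 := by
      intro a b hab ha
      refine cnt_eq_zero fun v => ?_
      by_contra hv
      refine ha.ne' (cnt_eq_zero fun u => ?_)
      by_contra hu
      exact hab (Prod.ext_iff.1 (h (a, u) (b, v) (by simpa [sub] using hu) (by simpa [sub] using hv))).1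
    have h0 := hs 0
    have h1 := hs 1
    have h2 := hs 2
    have h01 := hz 0 1 (by decide)
    have h02 := hz 0 2 (by decide)
    have h12 := hz 1 2 (by decide)
    simp only [cnt]
    omega

theorem cnt_le_add : ∀ {n} {X Y Z : WordSet n},
    (∀ u, X u = true → Y u = true ∨ Z u = true) → cnt X ≤ cnt Y + cnt Z
  | 0, X, Y, Z, h => by
    have := h ()
    cases hX : X () <;> cases hY : Y () <;> cases hZ : Z () <;> simp_all [cnt]
  | n + 1, X, Y, Z, h => by
    have := fun a => cnt_le_add (X := sub X a) (Y := sub Y a) (Z := sub Z a) fun u hu => h (a, u) hu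
    simp only [cnt]
    have h0 := this 0
    have h1 := this 1
    have h2 := this 2
    omega

theorem cnt_eq_sum {a b k : Fin 3} (hab : a ≠ b) (hka : k ≠ a) (hkb : k ≠ b)
    (X : WordSet (n + 1)) : cnt X = cnt (sub X a) + cnt (sub X b) + cnt (sub X k) := by
  simp only [cnt]
  fin_cases a <;> fin_cases b <;> fin_cases k <;> simp_all <;> omega

theorem third_eq {a b k : Fin 3} (hab : a ≠ b) (hka : k ≠ a) (hkb : k ≠ b) : third a b = k := by
  revert a b k; decide

theorem exists_third {a b : Fin 3} (hab : a ≠ b) : ∃ k, k ≠ a ∧ k ≠ b := by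
  revert a b; decide

theorem eq_of_ne {a b k : Fin 3} (hab : a ≠ b) (hka : k ≠ a) (hkb : k ≠ b) (x : Fin 3) :
    x = a ∨ x = b ∨ x = k := by
  revert a b k x; decide

theorem free_comm {a b : Fin 3} : ∀ {n} {X : WordSet n}, Free a b X → Free b a X
  | 0, _, h => h
  | _ + 1, _, h => ⟨free_comm h.2, free_comm h.1⟩

theorem free_mono {a b : Fin 3} : ∀ {n} {X Y : WordSet n}, (∀ u, X u = true → Y u = true) →
    Free a b Y → Free a b X
  | 0, X, Y, h, hY => by
    have := h ()
    simp_all [Free]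
  | _ + 1, _, _, h, hY => ⟨free_mono (fun u => h (a, u)) hY.1, free_mono (fun u => h (b, u)) hY.2⟩

theorem free_of_forall {a b : Fin 3} : ∀ {n} {X : WordSet n}, (∀ u, X u = false) → Free a b X
  | 0, _, h => h ()
  | _ + 1, _, h => ⟨free_of_forall fun u => h (a, u), free_of_forall fun u => h (b, u)⟩

theorem sees_cons {c a : Fin 3} {X : WordSet (n + 1)} {u : Word n} :
    Sees c X (a, u) ↔ Sees c (sub X a) u ∧ (a = c ∨ Free a c (sub X c)) := Iff.rfl

theorem sees_mono {c : Fin 3} : ∀ {n} {X Y : WordSet n} {u : Word n},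
    (∀ u, X u = true → Y u = true) → Sees c Y u → Sees c X u
  | 0, _, _, _, _, _ => trivial
  | _ + 1, _, _, (a, _), h, hY =>
    ⟨sees_mono (fun u => h (a, u)) hY.1, hY.2.imp_right fun hf => free_mono (fun u => h (c, u)) hf⟩

theorem vis_cons_self {a : Fin 3} {X : WordSet (n + 1)} {u v : Word n} :
    Vis X (a, u) (a, v) ↔ Vis (sub X a) u v := by
  simp [Vis]

/-- The compared lengths omit a common 1: the direct path has one joining edge, while the detour has
two and a side of `2 ^ n - 1` edges. -/
theorem vis_cons {a b k : Fin 3} (hab : a ≠ b) (hka : k ≠ a) (hkb : k ≠ b) {X : WordSet (n + 1)}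
    {u v : Word n} : Vis X (a, u) (b, v) ↔
      (dc b u + dc a v ≤ dc k u + 2 ^ n + dc k v ∧ Sees b (sub X a) u ∧ Sees a (sub X b) v) ∨
      (dc k u + 2 ^ n + dc k v ≤ dc b u + dc a v ∧ Sees k (sub X a) u ∧ Sees k (sub X b) v ∧
        Free a b (sub X k)) := by
  simp [Vis, hab, third_eq hab hka hkb]

theorem vis_mono : ∀ {n} {X Y : WordSet n} {u v : Word n},
    (∀ u, X u = true → Y u = true) → Vis Y u v → Vis X u v
  | 0, _, _, _, _, _, _ => trivial
  | n + 1, X, Y, (a, u), (b, v), h, hY => by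
    by_cases hab : a = b
    · subst hab
      rw [vis_cons_self] at hY ⊢
      exact vis_mono (fun u => h (a, u)) hY
    · obtain ⟨k, hka, hkb⟩ := exists_third hab
      rw [vis_cons hab hka hkb] at hY ⊢
      exact hY.imp
        (fun ⟨h1, h2, h3⟩ => ⟨h1, sees_mono (fun u => h (a, u)) h2, sees_mono (fun u => h (b, u)) h3⟩)
        (fun ⟨h1, h2, h3, h4⟩ => ⟨h1, sees_mono (fun u => h (a, u)) h2,
          sees_mono (fun u => h (b, u)) h3, free_mono (fun u => h (k, u)) h4⟩)

theorem mv_mono {X Y : WordSet n} (h : ∀ u, X u = true → Y u = true) (hY : MV Y) : MV X :=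
  fun u v hu hv => vis_mono h (hY u v (h u hu) (h v hv))

theorem mv_sub {X : WordSet (n + 1)} (h : MV X) (a : Fin 3) : MV (sub X a) :=
  fun u v hu hv => vis_cons_self.1 (h (a, u) (a, v) hu hv)

theorem all_sub {c : Fin 3} {X : WordSet (n + 1)} (h : All c X) (a : Fin 3) : All c (sub X a) :=
  fun u hu => (h (a, u) hu).1

theorem all_free {a c : Fin 3} {X : WordSet (n + 1)} (h : All c X) (hac : a ≠ c)
    (ha : (sub X a).Nonempty) : Free a c (sub X c) := by
  obtain ⟨u, hu⟩ := ha
  exact (h (a, u) hu).2.resolve_left hac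

theorem near_sub_neutral {k a b : Fin 3} {t : ℕ} (hbk : b ≠ k) (hba : b ≠ a)
    {X : WordSet (n + 1)} (h : Near k a t X) : Near k a t (sub X b) := by
  intro u hu
  have := h (b, u) hu
  simp only [dc_cons, if_neg hbk, if_neg hba] at this
  omega

/-- A first letter `a` costs `2 ^ n` in the distance to `k…k`, and the remaining letters add at most
`2 ^ n - 1` to the distance to `a…a`. -/
theorem near_sub_bad {k a : Fin 3} {t : ℕ} (hka : k ≠ a) (ht : 0 < t)
    {X : WordSet (n + 1)} (h : Near k a t X) : ∀ u, sub X a u = false := by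
  intro u
  by_contra hu
  have := h (a, u) (by simpa [sub] using hu)
  simp only [dc_cons, if_neg hka.symm, if_true] at this
  have := dc_lt a u
  omega

theorem near_le {k a : Fin 3} {s t : ℕ} (hst : s ≤ t) {X : WordSet n}
    (h : Near k a t X) : Near k a s X :=
  fun u hu => by have := h u hu; omega

theorem not_mem_of_free {a c : Fin 3} : ∀ {n} {X : WordSet n} {u : Word n}, Free a c X →
    dc c u = 0 → X u = false
  | 0, _, _, h, _ => h
  | n + 1, X, (b, u), h, hu => by
    simp only [dc_cons, Nat.add_eq_zero_iff, ite_eq_left_iff, Nat.pow_eq_zero] at hu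
    have hb : b = c := by by_contra h; simpa using hu.1 h
    subst hb
    exact not_mem_of_free h.2 hu.2

theorem not_sees_of_dc_eq_zero {k : Fin 3} : ∀ {n} {X : WordSet n} {u w : Word n}, X u = true →
    dc k u = 0 → w ≠ u → ¬ Sees k X w
  | 0, _, _, _, _, _, hw, _ => hw rfl
  | n + 1, X, (b, u), (a, w), hX, hu, hw, hs => by
    simp only [dc_cons, Nat.add_eq_zero_iff, ite_eq_left_iff, Nat.pow_eq_zero] at hu
    have hb : b = k := by by_contra h; simpa using hu.1 h
    subst hb
    by_cases hab : a = b
    · subst hab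
      exact not_sees_of_dc_eq_zero (X := sub X a) hX hu.2 (fun h => hw (Prod.ext rfl h)) hs.1
    · have := not_mem_of_free (hs.2.resolve_left hab) hu.2
      simp_all [sub]

theorem sees_of_unique {c : Fin 3} : ∀ {n} {X : WordSet n} {u : Word n}, X u = true →
    (∀ w, X w = true → w = u) → Sees c X u
  | 0, _, _, _, _ => trivial
  | n + 1, X, (a, u), hX, h => by
    refine ⟨sees_of_unique (X := sub X a) hX fun w hw => (Prod.ext_iff.1 (h (a, w) hw)).2, ?_⟩
    by_cases hac : a = c
    · exact Or.inl hac
    · refine Or.inr (free_of_forall fun w => ?_)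
      by_contra hw
      exact hac (Prod.ext_iff.1 (h (c, w) (by simpa [sub] using hw))).1.symm

/-- Some letter of `u` is `e`, since `u` is not on the side from `c…c` to `d…d`. The extremal word
is `d…de`, with distances `2 ^ n - 2` and `1`, hence the constant 3. -/
theorem dc_add_three_le {c d e : Fin 3} (hcd : c ≠ d) (hec : e ≠ c) (hed : e ≠ d) :
    ∀ {n} {X : WordSet n} {u : Word n}, X u = true → Free c d X → dc e u + 3 ≤ 2 ^ n + dc d u
  | 0, X, _, hX, hf => by simp_all [Free]
  | n + 1, X, (a, u), hX, hf => by
    have h2 : 0 < 2 ^ n := by positivity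
    simp only [dc_cons, pow_succ]
    rcases eq_of_ne hcd hec hed a with rfl | rfl | rfl
    · have := dc_add_three_le hcd hec hed (X := sub X a) hX hf.1
      rw [if_neg hec.symm, if_neg hcd]
      omega
    · have := dc_add_three_le hcd hec hed (X := sub X a) hX hf.2
      rw [if_neg hed.symm, if_pos rfl]
      omega
    · have := dc_lt a u
      rw [if_pos rfl, if_neg hed]
      omega

/-- Some word of `A` (in copy `a`) does not see copy `b`; all such words see all of `B` (in copy
`b`) through copy `k`. -/
def Blocked (A B : WordSet n) (a b k : Fin 3) : Prop :=
  ¬ All b A ∧ ∀ u, A u = true → ¬ Sees b A u → ∀ v, B v = true →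
    Sees k A u ∧ Sees k B v ∧ dc k u + 2 ^ n + dc k v ≤ dc b u + dc a v

/-- A word that does not see the joining edge leaves only the detour alternative in `vis_cons`,
whatever word of the other copy it is paired with. -/
theorem direct_or_blocked {X : WordSet (n + 1)} (h : MV X) {a b k : Fin 3} (hab : a ≠ b)
    (hka : k ≠ a) (hkb : k ≠ b) :
    All b (sub X a) ∧ All a (sub X b) ∨ Blocked (sub X a) (sub X b) a b k ∨
      Blocked (sub X b) (sub X a) b a k := by
  by_cases hA : All b (sub X a)
  · by_cases hB : All a (sub X b)
    · exact Or.inl ⟨hA, hB⟩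
    · refine Or.inr (Or.inr ⟨hB, fun u hu hs v hv => ?_⟩)
      have := (vis_cons hab.symm hkb hka).1 (h (b, u) (a, v) hu hv)
      tauto
  · refine Or.inr (Or.inl ⟨hA, fun u hu hs v hv => ?_⟩)
    have := (vis_cons hab hka hkb).1 (h (a, u) (b, v) hu hv)
    tauto

theorem Blocked.exists {A B : WordSet n} {a b k : Fin 3} (h : Blocked A B a b k) :
    ∃ u, A u = true ∧ ¬ Sees b A u := by
  simpa [All] using h.1

theorem Blocked.all {A B : WordSet n} {a b k : Fin 3} (h : Blocked A B a b k) : All k B := by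
  obtain ⟨u, hu, hs⟩ := h.exists
  exact fun v hv => (h.2 u hu hs v hv).2.1

/-- For a blind `u`, the detour saves at most `dc b u ≤ 2 ^ n - 1` at the end in copy `a`, while the
crossing costs `2 ^ n`; the end in copy `b` makes up the difference. If `u` is not the corner `k…k`,
one more unit is gained. -/
theorem Blocked.near {A B : WordSet n} {a b k : Fin 3} (h : Blocked A B a b k) : Near k a 1 B := by
  obtain ⟨u, hu, hs⟩ := h.exists
  intro v hv
  have h1 := (h.2 u hu hs v hv).2.2
  have h2 := dc_lt b u
  omega

theorem Blocked.near_two {A B : WordSet n} {a b k : Fin 3} (h : Blocked A B a b k) {u : Word n}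
    (hu : A u = true) (hs : ¬ Sees b A u) (h0 : dc k u ≠ 0) : Near k a 2 B := by
  intro v hv
  have h1 := (h.2 u hu hs v hv).2.2
  have h2 := dc_lt b u
  omega

end WordSet

-- Sets seeing two or three corners

namespace WordSet

variable {n : ℕ}

theorem cnt_sub_eq_zero {X : WordSet (n + 1)} {a : Fin 3} (h : ¬ (sub X a).Nonempty) :
    cnt (sub X a) = 0 := cnt_eq_zero (not_nonempty_iff.1 h)

/-- The bounds for sets all of whose words see two or three extreme vertices. -/
structure SeeingBounds (j : ℕ) : Prop where
  two : ∀ (X : WordSet (j + 2)) (c d : Fin 3), c ≠ d → MV X → All c X → All d X → cnt X ≤ 3 ^ j + 1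
  near : ∀ (X : WordSet (j + 2)) (d c : Fin 3), d ≠ c → MV X → All c X → All d X →
    Near d c 3 X → cnt X ≤ 3 ^ j
  three : ∀ (X : WordSet (j + 2)) (p q r : Fin 3), p ≠ q → p ≠ r → q ≠ r → MV X →
    All p X → All q X → All r X → Free p q X → Free p r X → cnt X ≤ 3 ^ j

theorem seeingBounds_zero : SeeingBounds 0 where
  two X c d hcd h hc hd := cnt_two_le_of_all_all X c d hcd hc hd h
  near X d c hdc _ _ _ h := cnt_two_le_of_near_three X d c hdc h
  three X p q r hpq hpr hqr _ hp hq _ hf hf' :=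
    cnt_two_le_of_all_all_free X p r q hpr hpq hqr.symm hf' hf hp hq

/-- A set seeing the corners `c`, `d` whose part in copy `c` is blocked from copy `e`. -/
theorem near_of_blocked {X : WordSet (n + 1)} {c d e : Fin 3} (hcd : c ≠ d) (hec : e ≠ c)
    (hed : e ≠ d) (hc : All c X) (hdn : (sub X d).Nonempty)
    (h : Blocked (sub X c) (sub X e) c e d) : Near d c 3 (sub X e) := by
  obtain ⟨u, hu, hs⟩ := h.exists
  have hf : Free c d (sub X c) := free_comm (all_free hc hcd.symm hdn)
  -- Copy `d` sees `c…c` through copy `c`, so the blind word `u` is off that side. This sharpens the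
  -- nearness from 1 to 3.
  have h1 := dc_add_three_le hcd hec hed hu hf
  intro v hv
  have h2 := (h.2 u hu hs v hv).2.2
  omega

/-- The three copies have at most `3 ^ j + 1` words each, so two must be saved. Each of the copies
`c`, `d` saves one: in itself if it sees `e…e` (by `three`), in copy `e` if it is blocked from it
(by `near`). Both cannot be blocked, as the nearness conditions on copy `e` are opposite. -/
theorem SeeingBounds.succ_two {j : ℕ} (ih : SeeingBounds j) (X : WordSet (j + 1 + 2))
    (c d : Fin 3) (hcd : c ≠ d) (h : MV X) (hc : All c X) (hd : All d X) :
    cnt X ≤ 3 ^ (j + 1) + 1 := by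
  obtain ⟨e, hec, hed⟩ := exists_third hcd
  have hj : 0 < 3 ^ j := by positivity
  have hF2 : ∀ a, cnt (sub X a) ≤ 3 ^ j + 1 := fun a =>
    ih.two _ c d hcd (mv_sub h a) (all_sub hc a) (all_sub hd a)
  have h1 := hF2 c
  have h2 := hF2 d
  have h3 := hF2 e
  rw [cnt_eq_sum hcd hec hed, pow_succ]
  by_cases hcn : (sub X c).Nonempty
  swap
  · rw [cnt_sub_eq_zero hcn]; omega
  by_cases hdn : (sub X d).Nonempty
  swap
  · rw [cnt_sub_eq_zero hdn]; omega
  by_cases hen : (sub X e).Nonempty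
  swap
  · rw [cnt_sub_eq_zero hen]; omega
  have hgc : All e (sub X c) → cnt (sub X c) ≤ 3 ^ j := fun he =>
    ih.three _ c d e hcd hec.symm hed.symm (mv_sub h c) (all_sub hc c) (all_sub hd c) he
      (free_comm (all_free hc hcd.symm hdn)) (free_comm (all_free hc hec hen))
  have hgd : All e (sub X d) → cnt (sub X d) ≤ 3 ^ j := fun he =>
    ih.three _ d c e hcd.symm hed.symm hec.symm (mv_sub h d) (all_sub hd d) (all_sub hc d) he
      (free_comm (all_free hd hcd hcn)) (free_comm (all_free hd hed hen))
  have hbc : All e (sub X c) ∨ Blocked (sub X c) (sub X e) c e d := by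
    rcases direct_or_blocked h hec.symm hcd.symm hed.symm with h' | h' | h'
    · exact Or.inl h'.1
    · exact Or.inr h'
    · exact absurd (all_sub hc e) h'.1
  have hbd : All e (sub X d) ∨ Blocked (sub X d) (sub X e) d e c := by
    rcases direct_or_blocked h hed.symm hcd hec.symm with h' | h' | h'
    · exact Or.inl h'.1
    · exact Or.inr h'
    · exact absurd (all_sub hd e) h'.1
  rcases hbc with hbc | hbc
  · have := hgc hbc
    rcases hbd with hbd | hbd
    · have := hgd hbd
      omega
    · have := ih.near _ c d hcd (mv_sub h e) (all_sub hd e) (all_sub hc e)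
        (near_of_blocked hcd.symm hed hec hd hcn hbd)
      omega
  · have hn := near_of_blocked hcd hec hed hc hdn hbc
    rcases hbd with hbd | hbd
    · have := hgd hbd
      have := ih.near _ d c hcd.symm (mv_sub h e) (all_sub hc e) (all_sub hd e) hn
      omega
    · have hn' := near_of_blocked hcd.symm hed hec hd hcn hbd
      obtain ⟨v, hv⟩ := hen
      have := hn v hv
      have := hn' v hv
      omega

theorem SeeingBounds.succ_near {j : ℕ} (ih : SeeingBounds j) (X : WordSet (j + 1 + 2))
    (d c : Fin 3) (hdc : d ≠ c) (h : MV X) (hc : All c X) (hd : All d X) (hn : Near d c 3 X) :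
    cnt X ≤ 3 ^ (j + 1) := by
  obtain ⟨e, hed, hec⟩ := exists_third hdc
  have hj : 0 < 3 ^ j := by positivity
  have h1 := ih.two _ c d hdc.symm (mv_sub h d) (all_sub hc d) (all_sub hd d)
  have h2 := ih.near _ d c hdc (mv_sub h e) (all_sub hc e) (all_sub hd e)
    (near_sub_neutral hed hec hn)
  rw [cnt_eq_sum hdc hed hec, cnt_eq_zero (near_sub_bad hdc (by omega) hn), pow_succ]
  omega

/-- Seeing a corner across another nonempty copy supplies the free sides that the assumption does
not give, so the hypotheses are inherited by each copy unless `q` or `r` is empty. -/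
theorem SeeingBounds.succ_three {j : ℕ} (ih : SeeingBounds j) (X : WordSet (j + 1 + 2))
    (p q r : Fin 3) (hpq : p ≠ q) (hpr : p ≠ r) (hqr : q ≠ r) (h : MV X) (hp : All p X)
    (hq : All q X) (hr : All r X) (hf : Free p q X) (hf' : Free p r X) : cnt X ≤ 3 ^ (j + 1) := by
  have hj : 0 < 3 ^ j := by positivity
  have hF2 : ∀ a, cnt (sub X a) ≤ 3 ^ j + 1 := fun a =>
    ih.two _ p q hpq (mv_sub h a) (all_sub hp a) (all_sub hq a)
  have hP : cnt (sub X p) ≤ 3 ^ j := ih.three _ p q r hpq hpr hqr (mv_sub h p) (all_sub hp p)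
    (all_sub hq p) (all_sub hr p) hf.1 hf'.1
  have hQ : (sub X r).Nonempty → cnt (sub X q) ≤ 3 ^ j := fun hn =>
    ih.three _ q p r hpq.symm hqr hpr (mv_sub h q) (all_sub hq q) (all_sub hp q) (all_sub hr q)
      (free_comm hf.2) (free_comm (all_free hq hqr.symm hn))
  have hR : (sub X q).Nonempty → cnt (sub X r) ≤ 3 ^ j := fun hn =>
    ih.three _ r p q hpr.symm hqr.symm hpq (mv_sub h r) (all_sub hr r) (all_sub hp r) (all_sub hq r)
      (free_comm hf'.2) (free_comm (all_free hr hqr hn))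
  have h1 := hF2 q
  have h2 := hF2 r
  rw [cnt_eq_sum hpq hpr.symm hqr.symm, pow_succ]
  by_cases hqn : (sub X q).Nonempty
  · have := hR hqn
    by_cases hrn : (sub X r).Nonempty
    · have := hQ hrn
      omega
    · rw [cnt_sub_eq_zero hrn]; omega
  · rw [cnt_sub_eq_zero hqn]; omega

theorem seeingBounds : ∀ j, SeeingBounds j
  | 0 => seeingBounds_zero
  | j + 1 => ⟨(seeingBounds j).succ_two, (seeingBounds j).succ_near, (seeingBounds j).succ_three⟩

-- Length three: small sets with strong nearness

theorem dc_two_le (c : Fin 3) (u : Word 2) : dc c u ≤ 3 := Nat.le_of_lt_succ (dc_lt c u)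

theorem cnt_three_le_of_near_four (X : WordSet (2 + 1)) {k a : Fin 3} (hka : k ≠ a) (hk : All k X)
    (h : Near k a 4 X) : cnt X ≤ 2 := by
  obtain ⟨b, hbk, hba⟩ := exists_third hka
  have hb : ∀ u, sub X b u = false := by
    intro u
    by_contra hu
    have h1 := near_sub_neutral hbk hba h u (by simpa [sub] using hu)
    have h2 := dc_two_le a u
    omega
  rw [cnt_eq_sum hka hbk hba, cnt_eq_zero (near_sub_bad hka (by omega) h), cnt_eq_zero hb]
  -- Only copy `k` is left; its first letter accounts for `2 ^ 2 = 4`, so nearness 0 remains.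
  refine (cnt_two_le_of_near_zero (sub X k) k a hka (all_sub hk k) fun u hu => ?_)
  have := h (k, u) hu
  rw [dc_cons k k u, dc_cons a k u] at this
  simp only [if_neg hka, if_true, Nat.reducePow] at this
  omega

/-- If some words of `X` do not see `b…b` but all of these are much nearer to `k…k`,
then `X` is small. -/
theorem cnt_three_le_of_blind_near (X : WordSet (2 + 1)) {k b : Fin 3} (hkb : k ≠ b) (hk : All k X)
    (h : MV X) (hb : ¬ All b X) (hn : ∀ u, X u = true → ¬ Sees b X u → dc k u + 4 ≤ dc b u) :
    cnt X ≤ 3 := by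
  obtain ⟨a, hak, hab⟩ := exists_third hkb
  have hle : ∀ u, X (k, u) = true → ¬ Sees b X (k, u) → dc k u ≤ dc b u := by
    intro u hu hs
    have := hn (k, u) hu hs
    rw [dc_cons k k u, dc_cons b k u] at this
    simp only [if_neg hkb, if_true, Nat.reducePow] at this
    omega
  have hsb : All b (sub X b) := by
    intro u hu
    by_contra hs
    have h1 := hn (b, u) hu (fun h => hs h.1)
    rw [dc_cons k b u, dc_cons b b u] at h1
    simp only [if_neg hkb.symm, if_true, Nat.reducePow] at h1
    have := dc_two_le b u
    omega
  have hsa : ∀ u, sub X a u = true → Sees b X (a, u) := by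
    intro u hu
    by_contra hs
    have h1 := hn (a, u) hu hs
    rw [dc_cons k a u, dc_cons b a u] at h1
    simp only [if_neg hak, if_neg hab, Nat.reducePow] at h1
    have := dc_two_le b u
    omega
  obtain ⟨x, u, hu, hs⟩ : ∃ x u, X (x, u) = true ∧ ¬ Sees b X (x, u) := by
    simpa [All] using hb
  have hx : x = k := by
    rcases eq_of_ne hkb hak hab x with rfl | rfl | rfl
    · rfl
    · exact absurd ⟨hsb u hu, Or.inl rfl⟩ hs
    · exact absurd (hsa u hu) hs
  subst hx
  rw [cnt_eq_sum hkb hak hab]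
  have hB := cnt_two_le_of_all_all (sub X b) x b hkb (all_sub hk b) hsb (mv_sub h b)
  -- Copy `a` is in fact empty: otherwise the blind word `u` sees `b…b` inside its copy, so the
  -- obstruction lies in copy `b`. Then two sides of copy `k` are free, which puts `u` nearer to
  -- `b…b`, a contradiction.
  by_cases han : (sub X a).Nonempty
  · have hfa := all_free hk hak han
    have hsee := sees_of_free_of_le (sub X x) a b x hab hak.symm hkb hfa (all_sub hk x)
    have h1 := hsee u hu (hle u hu hs)
    have hfx : ¬ Free x b (sub X b) := fun hf => hs ⟨h1, Or.inr hf⟩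
    have hbn : (sub X b).Nonempty := by
      by_contra hbn
      exact hfx (free_of_forall (not_nonempty_iff.1 hbn))
    have := dc_lt_of_free_free (sub X x) a b x hab hak.symm hkb hfa (all_free hk hkb.symm hbn) u hu
    have := hle u hu hs
    omega
  rw [cnt_sub_eq_zero han]
  by_cases hbn : (sub X b).Nonempty
  swap
  · rw [cnt_sub_eq_zero hbn]
    have := cnt_two_le_of_all (sub X x) x (all_sub hk x) (mv_sub h x)
    omega
  have hfb := all_free hk hkb.symm hbn
  -- If the side of copy `b` is free, `u` is blind already inside its copy and all of copy `b` is
  -- seen by a detour through `a`; if not, the whole of copy `k` is blind, hence near.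
  by_cases hfx : Free x b (sub X b)
  · have hs' : ¬ Sees b (sub X x) u := fun h' => hs ⟨h', Or.inr hfx⟩
    have hB' : ∀ v, sub X b v = true → Sees a (sub X b) v ∧ dc a v + 1 ≤ dc x v := by
      intro v hv
      have h1 := (vis_cons hkb hak hab).1 (h (x, u) (b, v) hu hv)
      have h2 := dc_two_le b u
      rcases h1 with h1 | h1
      · exact absurd h1.2.1 hs'
      · exact ⟨h1.2.2.1, by omega⟩
    have := cnt_two_le_of_all_near_one (sub X b) a b x hab hak.symm hkb (fun v hv => (hB' v hv).2)
      (fun v hv => (hB' v hv).1) hsb (all_sub hk b)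
    have := cnt_two_le_of_all_free (sub X x) x b hkb (free_comm hfb) (all_sub hk x) (mv_sub h x)
    omega
  · have := cnt_two_le_of_free_near_zero (sub X x) x b hkb hfb
      (fun v hv => hle v hv fun h' => hfx (h'.2.resolve_left hkb)) (all_sub hk x)
    omega

/-- Sets in which every word fails to see at most one of `b…b`, `k…k`, and those failing to see
one are much nearer to the other. -/
theorem cnt_three_le_of_blind_blind (X : WordSet (2 + 1)) {k b : Fin 3} (hkb : k ≠ b) (h : MV X)
    (hb : ¬ All b X) (hk : ¬ All k X)
    (hnb : ∀ u, X u = true → ¬ Sees b X u → Sees k X u ∧ dc k u + 5 ≤ dc b u)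
    (hnk : ∀ u, X u = true → ¬ Sees k X u → Sees b X u ∧ dc b u + 5 ≤ dc k u) : cnt X ≤ 5 := by
  obtain ⟨a, hak, hab⟩ := exists_third hkb
  have key : ∀ {k b : Fin 3}, k ≠ b → a ≠ k → a ≠ b → ¬ All b X →
      (∀ u, X u = true → ¬ Sees b X u → Sees k X u ∧ dc k u + 5 ≤ dc b u) →
      (∀ u, X (b, u) = true → Sees b X (b, u)) ∧ (∀ u, X (a, u) = true → Sees b X (a, u)) ∧
      ∃ u, X (k, u) = true ∧ dc k u + 1 ≤ dc b u := by
    intro k b hkb hak hab hb hnb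
    have hsb : ∀ u, X (b, u) = true → Sees b X (b, u) := by
      intro u hu
      by_contra hs
      have h1 := (hnb (b, u) hu hs).2
      rw [dc_cons k b u, dc_cons b b u] at h1
      simp only [if_neg hkb.symm, if_true, Nat.reducePow] at h1
      have := dc_two_le b u
      omega
    have hsa : ∀ u, X (a, u) = true → Sees b X (a, u) := by
      intro u hu
      by_contra hs
      have h1 := (hnb (a, u) hu hs).2
      rw [dc_cons k a u, dc_cons b a u] at h1
      simp only [if_neg hak, if_neg hab, Nat.reducePow] at h1
      have := dc_two_le b u
      omega
    refine ⟨hsb, hsa, ?_⟩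
    obtain ⟨x, u, hu, hs⟩ : ∃ x u, X (x, u) = true ∧ ¬ Sees b X (x, u) := by
      simpa [All] using hb
    rcases eq_of_ne hkb hak hab x with rfl | rfl | rfl
    · have := (hnb _ hu hs).2
      rw [dc_cons x x u, dc_cons b x u] at this
      simp only [if_neg hkb, if_true, Nat.reducePow] at this
      exact ⟨u, hu, by omega⟩
    · exact absurd (hsb u hu) hs
    · exact absurd (hsa u hu) hs
  obtain ⟨hbb, hab', u, hu, hul⟩ := key hkb hak hab hb hnb
  obtain ⟨hkk, hak', v, hv, hvl⟩ := key hkb.symm hab hak hk hnk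
  have hAk : All k (sub X k) := fun u hu => (hkk u hu).1
  have hAb : All b (sub X b) := fun u hu => (hbb u hu).1
  have hdb : (∀ w, X (b, w) = true → ¬ Sees k X (b, w)) → Near b k 1 (sub X b) := by
    intro hw w hw'
    have := (hnk _ hw' (hw w hw')).2
    rw [dc_cons b b w, dc_cons k b w] at this
    simp only [if_neg hkb.symm, if_true, Nat.reducePow] at this
    omega
  have hdk : (∀ w, X (k, w) = true → ¬ Sees b X (k, w)) → Near k b 1 (sub X k) := by
    intro hw w hw'
    have := (hnb _ hw' (hw w hw')).2
    rw [dc_cons k k w, dc_cons b k w] at this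
    simp only [if_neg hkb, if_true, Nat.reducePow] at this
    omega
  rw [cnt_eq_sum hkb hak hab]
  by_cases han : (sub X a).Nonempty
  · obtain ⟨w, hw⟩ := han
    have hfk : Free a k (sub X k) := (hak' w hw).2.resolve_left hak
    have hfb : Free a b (sub X b) := (hab' w hw).2.resolve_left hab
    have hA := cnt_two_le_of_all_all (sub X a) k b hkb (fun w hw => (hak' w hw).1)
      (fun w hw => (hab' w hw).1) (mv_sub h a)
    have hB : cnt (sub X b) ≤ 1 := by
      refine cnt_two_le_of_free_near_one (sub X b) b k a hkb.symm hab.symm hak.symm hfb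
        (hdb fun z hz hs => ?_) hAb
      have := dc_lt_of_free_free (sub X k) a b k hab hak.symm hkb hfk
        (hs.2.resolve_left hkb.symm) u hu
      omega
    have hK : cnt (sub X k) ≤ 1 := by
      refine cnt_two_le_of_free_near_one (sub X k) k b a hkb hak.symm hab.symm hfk
        (hdk fun z hz hs => ?_) hAk
      have := dc_lt_of_free_free (sub X b) a k b hak hab.symm hkb.symm hfb
        (hs.2.resolve_left hkb) v hv
      omega
    omega
  · rw [cnt_sub_eq_zero han]
    have hK := cnt_two_le_of_all (sub X k) k hAk (mv_sub h k)
    have hB := cnt_two_le_of_all (sub X b) b hAb (mv_sub h b)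
    by_cases hs : ∀ w, X (b, w) = true → ¬ Sees k X (b, w)
    · have := cnt_two_le_of_near_zero (sub X b) b k hkb.symm hAb (near_le (by omega) (hdb hs))
      omega
    · push Not at hs
      obtain ⟨w, hw, hs⟩ := hs
      have := cnt_two_le_of_all_free (sub X k) k b hkb
        (free_comm (hs.2.resolve_left hkb.symm)) hAk (mv_sub h k)
      omega

end WordSet

-- The main induction: blocked pairs and triples of copies

namespace WordSet

variable {n : ℕ}

/-- The bounds for mutual-visibility sets under at most one condition on seen corners, with or
without nearness to a seen corner. -/
structure Bounds (j : ℕ) : Prop where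
  any : ∀ X : WordSet (j + 2), MV X → cnt X ≤ 3 ^ j + 3
  one : ∀ (X : WordSet (j + 2)) (c : Fin 3), MV X → All c X → cnt X ≤ 3 ^ j + 2
  near_one : ∀ (X : WordSet (j + 2)) (k a : Fin 3), k ≠ a → MV X → All k X → Near k a 1 X →
    cnt X ≤ 3 ^ j + 1 ∧ (2 ≤ j → cnt X ≤ 3 ^ j)
  near_two : ∀ (X : WordSet (j + 2)) (k a : Fin 3), k ≠ a → MV X → All k X → Near k a 2 X →
    cnt X ≤ 3 ^ j ∧ (2 ≤ j → cnt X + 1 ≤ 3 ^ j)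

theorem bounds_zero : Bounds 0 where
  any X h := cnt_two_le X h
  one X c h hc := cnt_two_le_of_all X c hc h
  near_one X k a hka _ hk hn :=
    ⟨cnt_two_le_of_near_zero X k a hka hk (near_le (by omega) hn), by omega⟩
  near_two X k a hka _ hk hn := ⟨cnt_two_le_of_near_two X k a hka hk hn, by omega⟩

theorem three_pow_le_of_le {i j : ℕ} (h : i ≤ j) : 3 ^ i ≤ 3 ^ j := Nat.pow_le_pow_right (by omega) h

/-- The bounds `one` for `A` and `near_one` for `B` add up to `2 * 3 ^ j + 3`. The more a blind word
of `A` favours `k…k`, the smaller `A`; the less it does, the nearer `B` must be to `k…k`. -/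
theorem Bounds.pair {j : ℕ} (ih : Bounds j) {A B : WordSet (j + 2)} {a b k : Fin 3}
    (hka : k ≠ a) (hkb : k ≠ b) (hA : MV A) (hB : MV B) (hk : All k A) (hn : B.Nonempty)
    (h : Blocked A B a b k) :
    cnt A + cnt B ≤ 2 * 3 ^ j + 2 ∧ (1 ≤ j → cnt A + cnt B ≤ 2 * 3 ^ j + 1) := by
  obtain ⟨v, hv⟩ := hn
  have h1 := ih.one A k hA hk
  have h2 := (ih.near_one B k a hka hB h.all h.near).1
  rcases j with _ | _ | j
  · have := cnt_two_le_of_blind_near A k b hkb hk hA h.1 fun u hu hs => by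
      have h3 := (h.2 u hu hs v hv).2.2
      have h4 := dc_two_le a v
      omega
    omega
  · by_cases hU : ∀ u, A u = true → ¬ Sees b A u → dc k u + 4 ≤ dc b u
    · have := cnt_three_le_of_blind_near A hkb hk hA h.1 hU
      omega
    · push Not at hU
      obtain ⟨u, hu, hs, hlt⟩ := hU
      have := cnt_three_le_of_near_four B hka h.all fun v hv => by
        have := (h.2 u hu hs v hv).2.2
        omega
      omega
  -- A word of `A` at `k…k` would hide that corner from all others, so it would be the only word and
  -- see everything. The blind word is thus off the corner and `B` has nearness 2.
  · obtain ⟨u, hu, hs⟩ := h.exists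
    have h0 : dc k u ≠ 0 := by
      intro h0
      refine hs (sees_of_unique hu fun w hw => ?_)
      by_contra hwu
      exact not_sees_of_dc_eq_zero hu h0 hwu (hk w hw)
    have := (ih.near_two B k a hka hB h.all (h.near_two hu hs h0)).2 (by omega)
    omega

/-- The words of `A` not seeing `k…k`. -/
noncomputable def blind (k : Fin 3) (A : WordSet n) : WordSet n :=
  fun u => A u && decide (¬ Sees k A u)

theorem blind_iff {k : Fin 3} {A : WordSet n} {u : Word n} :
    blind k A u = true ↔ A u = true ∧ ¬ Sees k A u := by
  simp [blind]

theorem blind_le {k : Fin 3} {A : WordSet n} (u : Word n) (h : blind k A u = true) : A u = true :=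
  (blind_iff.1 h).1

/-- A word at `k…k` hides that corner from every other word. -/
theorem cnt_le_one_add_blind {k : Fin 3} {A : WordSet n} {u : Word n} (hu : A u = true)
    (h0 : dc k u = 0) : cnt A ≤ 1 + cnt (blind k A) := by
  refine (cnt_le_add (Y := fun w => decide (w = u)) (Z := blind k A) fun w hw => ?_).trans
    (Nat.add_le_add_right (cnt_le_one fun x y hx hy => ?_) _)
  · by_cases hwu : w = u
    · simp [hwu]
    · exact Or.inr (blind_iff.2 ⟨hw, not_sees_of_dc_eq_zero hu h0 hwu⟩)
  · simp_all

theorem blind_blocked {A C : WordSet n} {a b k : Fin 3} (hn : C.Nonempty)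
    (h : Blocked A C a k b) : All b (blind k A) ∧ Near b k 1 (blind k A) := by
  obtain ⟨v, hv⟩ := hn
  refine ⟨fun u hu => sees_mono blind_le (h.2 u (blind_iff.1 hu).1 (blind_iff.1 hu).2 v hv).1,
    fun u hu => ?_⟩
  have h1 := (h.2 u (blind_iff.1 hu).1 (blind_iff.1 hu).2 v hv).2.2
  have := dc_lt a v
  omega

/-- The bound on the total size of `A`, `B`, `C` when `A` contains the corner `k…k`. -/
theorem Bounds.triple_corner {j : ℕ} (ih : Bounds j) {A B C : WordSet (j + 2)} {a b k : Fin 3}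
    (hab : a ≠ b) (hka : k ≠ a) (hkb : k ≠ b) (hA : MV A) (hB : MV B) (hC : MV C)
    (hCn : C.Nonempty) (h : Blocked A B a b k) (h' : Blocked A C a k b)
    {u : Word (j + 2)} (hu : A u = true) (h0 : dc k u = 0) :
    cnt A + cnt B + cnt C ≤ 3 * 3 ^ j + 3 ∧
      (1 ≤ j → cnt A + cnt B + cnt C ≤ 3 * 3 ^ j + 2) := by
  have hA1 := cnt_le_one_add_blind hu h0
  obtain ⟨hUb, hUn⟩ := blind_blocked hCn h'
  have hUm := mv_mono blind_le hA (X := blind k A)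
  have hU := ih.near_one _ b k hkb.symm hUm hUb hUn
  have hB1 := ih.near_one B k a hka hB h.all h.near
  have hC1 := ih.near_one C b a hab.symm hC h'.all h'.near
  -- Either the words blind to `k…k` all sit at `b…b`, so `A` has at most two words, or one of them
  -- is off `b…b` and gives `C` nearness 2.
  by_cases hc : ∀ x, A x = true → ¬ Sees k A x → dc b x = 0
  · have : cnt (blind k A) ≤ 1 := cnt_le_one fun x y hx hy => by
      rw [blind_iff] at hx hy
      exact eq_of_dc_eq_zero (hc x hx.1 hx.2) (hc y hy.1 hy.2)
    rcases j with _ | j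
    · omega
    · have : 0 < 3 ^ j := by positivity
      simp only [pow_succ] at *
      omega
  push Not at hc
  obtain ⟨x, hx, hs, hx0⟩ := hc
  have hC2 := ih.near_two C b a hab.symm hC h'.all (h'.near_two hx hs hx0)
  rcases j with _ | _ | j
  · omega
  · by_cases hq : ∀ x, blind k A x = true → dc b x + 4 ≤ dc k x
    · have := cnt_three_le_of_near_four _ hkb.symm hUb hq
      omega
    · push Not at hq
      obtain ⟨y, hy, hlt⟩ := hq
      rw [blind_iff] at hy
      have := cnt_three_le_of_near_four C hab.symm h'.all fun v hv => by
        have := (h'.2 y hy.1 hy.2 v hv).2.2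
        omega
      omega
  · have := hU.2 (by omega)
    have := hB1.2 (by omega)
    have := hC2.2 (by omega)
    omega

theorem Bounds.triple {j : ℕ} (ih : Bounds j) {A B C : WordSet (j + 2)} {a b k : Fin 3}
    (hab : a ≠ b) (hka : k ≠ a) (hkb : k ≠ b) (hA : MV A) (hB : MV B) (hC : MV C)
    (hBn : B.Nonempty) (hCn : C.Nonempty) (h : Blocked A B a b k) (h' : Blocked A C a k b) :
    cnt A + cnt B + cnt C ≤ 3 * 3 ^ j + 3 ∧
      (1 ≤ j → cnt A + cnt B + cnt C ≤ 3 * 3 ^ j + 2) := by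
  obtain ⟨u, hu, hs⟩ := h.exists
  obtain ⟨x, hx, hxs⟩ := h'.exists
  by_cases h0 : dc k u = 0
  · exact ih.triple_corner hab hka hkb hA hB hC hCn h h' hu h0
  by_cases hx0 : dc b x = 0
  · have := ih.triple_corner hka.symm hab.symm hkb.symm hA hC hB hBn h' h hx hx0
    omega
  have hB2 := ih.near_two B k a hka hB h.all (h.near_two hu hs h0)
  have hC2 := ih.near_two C b a hab.symm hC h'.all (h'.near_two hx hxs hx0)
  have hA3 := ih.any A hA
  rcases j with _ | _ | j
  · omega
  -- The threshold 5 matches the crossing cost `2 ^ 3 = 8`: a blind word with advantage at most 4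
  -- forces nearness 4 on the other copy.
  · by_cases hp : ∀ u, A u = true → ¬ Sees b A u → dc k u + 5 ≤ dc b u
    · by_cases hq : ∀ u, A u = true → ¬ Sees k A u → dc b u + 5 ≤ dc k u
      · obtain ⟨v, hv⟩ := hBn
        obtain ⟨w, hw⟩ := hCn
        have := cnt_three_le_of_blind_blind A hkb hA h.1 h'.1
          (fun u hu hs => ⟨(h.2 u hu hs v hv).1, hp u hu hs⟩)
          (fun u hu hs => ⟨(h'.2 u hu hs w hw).1, hq u hu hs⟩)
        omega
      · push Not at hq
        obtain ⟨y, hy, hys, hlt⟩ := hq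
        have := cnt_three_le_of_near_four C hab.symm h'.all fun v hv => by
          have := (h'.2 y hy hys v hv).2.2
          omega
        omega
    · push Not at hp
      obtain ⟨y, hy, hys, hlt⟩ := hp
      have := cnt_three_le_of_near_four B hka h.all fun v hv => by
        have := (h.2 y hy hys v hv).2.2
        omega
      omega
  · have := hB2.2 (by omega)
    have := hC2.2 (by omega)
    omega

/-- Copy `a` is empty, copy `b` inherits the nearness, and copy `k` keeps only `one`. The total is
about `2 * 3 ^ j`, which explains the better bounds for larger lengths. -/
theorem Bounds.succ_near {j : ℕ} (ih : Bounds j) (X : WordSet (j + 1 + 2)) (k a : Fin 3)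
    (hka : k ≠ a) (h : MV X) (hk : All k X) :
    (Near k a 1 X → cnt X ≤ 3 ^ (j + 1) + 1 ∧ (2 ≤ j + 1 → cnt X ≤ 3 ^ (j + 1))) ∧
    (Near k a 2 X → cnt X ≤ 3 ^ (j + 1) ∧ (2 ≤ j + 1 → cnt X + 1 ≤ 3 ^ (j + 1))) := by
  obtain ⟨b, hbk, hba⟩ := exists_third hka
  have h1 := ih.one _ k (mv_sub h k) (all_sub hk k)
  rw [cnt_eq_sum hka hbk hba, pow_succ]
  have hj : j = 0 ∨ 3 ≤ 3 ^ j := by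
    rcases j with _ | j
    · exact Or.inl rfl
    · exact Or.inr (by rw [pow_succ]; have : 0 < 3 ^ j := by positivity
                       omega)
  have hz : j = 0 → (sub X b).Nonempty → cnt (sub X k) ≤ 2 := by
    rintro rfl hn
    exact cnt_two_le_of_all_free (sub X k) k b hbk.symm (free_comm (all_free hk hbk hn))
      (all_sub hk k) (mv_sub h k)
  have he : ¬ (sub X b).Nonempty → cnt (sub X b) = 0 := cnt_sub_eq_zero
  have hj' : j = 0 → 3 ^ j = 1 := by rintro rfl; rfl
  have ho := ih.near_one (sub X b) k a hka (mv_sub h b) (all_sub hk b)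
  have ht := ih.near_two (sub X b) k a hka (mv_sub h b) (all_sub hk b)
  by_cases hbn : (sub X b).Nonempty
  · simp only [hbn, forall_true_left] at hz
    refine ⟨fun hn => ?_, fun hn => ?_⟩
    · rw [cnt_eq_zero (near_sub_bad hka (by omega) hn)]
      have := (ho (near_sub_neutral hbk hba hn)).1
      omega
    · rw [cnt_eq_zero (near_sub_bad hka (by omega) hn)]
      have := (ht (near_sub_neutral hbk hba hn)).1
      omega
  · have := he hbn
    refine ⟨fun hn => ?_, fun hn => ?_⟩
    · rw [cnt_eq_zero (near_sub_bad hka (by omega) hn)]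
      omega
    · rw [cnt_eq_zero (near_sub_bad hka (by omega) hn)]
      omega

/-- If `{a, b}` is blocked through `k`, then copies `k` and `b` see each other directly. -/
theorem direct_of_blocked {X : WordSet (n + 1)} (h : MV X) {a b k : Fin 3} (hab : a ≠ b)
    (hka : k ≠ a) (hkb : k ≠ b) (hbn : (sub X b).Nonempty)
    (hB : Blocked (sub X a) (sub X b) a b k) : All b (sub X k) := by
  rcases direct_or_blocked h hkb hka.symm hab with h' | h' | h'
  · exact h'.1
  · obtain ⟨v, hv⟩ := hbn
    have h1 := hB.near v hv
    have h2 := h'.near v hv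
    omega
  · exact absurd hB.all h'.1

theorem Bounds.succ_any_of_blocked {j : ℕ} (ih : Bounds j) (X : WordSet (j + 1 + 2)) (h : MV X)
    {a b k : Fin 3} (hab : a ≠ b) (hka : k ≠ a) (hkb : k ≠ b) (hbn : (sub X b).Nonempty)
    (hB : Blocked (sub X a) (sub X b) a b k) :
    cnt X ≤ 3 ^ (j + 1) + 3 ∧ (1 ≤ j → cnt X ≤ 3 ^ (j + 1) + 2) := by
  have hj : 0 < 3 ^ j := by positivity
  have hj' : 1 ≤ j → 3 ≤ 3 ^ j := fun h1 => three_pow_le_of_le (i := 1) h1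
  rw [cnt_eq_sum hab hka hkb, pow_succ]
  by_cases hkn : (sub X k).Nonempty
  · have hKb := direct_of_blocked h hab hka hkb hbn hB
    -- Copy `k` sees `b…b`. If it is also direct with copy `a`, it sees two corners and the other
    -- two copies form a `pair`; otherwise copy `a` is blocked from both others, a `triple`.
    rcases direct_or_blocked h hka.symm hab.symm hkb.symm with h' | h' | h'
    · have h1 := ih.pair hka hkb (mv_sub h a) (mv_sub h b) h'.1 hbn hB
      have h2 := (seeingBounds j).two (sub X k) a b hab (mv_sub h k) h'.2 hKb
      omega
    · have := ih.triple hab hka hkb (mv_sub h a) (mv_sub h b) (mv_sub h k) hbn hkn hB h'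
      omega
    · exact absurd h'.all hB.1
  · have h1 := ih.any _ (mv_sub h a)
    have h2 := (ih.near_one _ k a hka (mv_sub h b) hB.all hB.near).1
    rw [cnt_sub_eq_zero hkn]
    omega

end WordSet

-- The main induction: sets seeing one corner, and the final bounds

namespace WordSet

variable {n : ℕ}

theorem Bounds.succ_one_of_empty {j : ℕ} (ih : Bounds j) (X : WordSet (j + 1 + 2)) (h : MV X)
    {c p q : Fin 3} (hcp : c ≠ p) (hqc : q ≠ c) (hqp : q ≠ p) (hc : All c X)
    (hp : ¬ (sub X p).Nonempty) : cnt X ≤ 3 ^ (j + 1) + 2 := by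
  have h1 := ih.one _ c (mv_sub h c) (all_sub hc c)
  have h2 := ih.one _ c (mv_sub h q) (all_sub hc q)
  rw [cnt_eq_sum hcp hqc hqp, cnt_sub_eq_zero hp, pow_succ]
  by_cases hqn : (sub X q).Nonempty
  · rcases j with _ | j
    · have := cnt_two_le_of_all_free (sub X c) c q hqc.symm (free_comm (all_free hc hqc hqn))
        (all_sub hc c) (mv_sub h c)
      omega
    · have : 0 < 3 ^ j := by positivity
      simp only [pow_succ] at *
      omega
  · rw [cnt_sub_eq_zero hqn]
    omega

/-- The bound for sets seeing `c…c` when copies `p` and `q` are blocked from each other. -/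
theorem Bounds.succ_one_of_blocked {j : ℕ} (ih : Bounds j) (X : WordSet (j + 1 + 2)) (h : MV X)
    {c p q : Fin 3} (hcp : c ≠ p) (hqc : q ≠ c) (hqp : q ≠ p) (hc : All c X)
    (hpn : (sub X p).Nonempty) (hqn : (sub X q).Nonempty)
    (hB : Blocked (sub X p) (sub X q) p q c) : cnt X ≤ 3 ^ (j + 1) + 2 := by
  have h1 := (ih.pair hcp hqc.symm (mv_sub h p) (mv_sub h q) (all_sub hc p) hqn hB).1
  have hcq := direct_of_blocked h hqp.symm hcp hqc.symm hqn hB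
  have hcp' : All p (sub X c) := by
    rcases direct_or_blocked h hcp hqc hqp with h' | h' | h'
    · exact h'.1
    · exact absurd h'.all hB.1
    · exact absurd (all_sub hc p) h'.1
  have h2 := (seeingBounds j).three (sub X c) c p q hcp hqc.symm hqp.symm (mv_sub h c)
    (all_sub hc c) hcp' hcq (free_comm (all_free hc hcp.symm hpn))
    (free_comm (all_free hc hqc hqn))
  rw [cnt_eq_sum hcp hqc hqp, pow_succ]
  omega

/-- The bound for sets seeing `c…c` when copies `p` and `q` see each other directly, and all of
copy `c` sees copy `q`. -/
theorem Bounds.succ_one_of_direct {j : ℕ} (ih : Bounds j) (X : WordSet (j + 1 + 2)) (h : MV X)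
    {c p q : Fin 3} (hcp : c ≠ p) (hqc : q ≠ c) (hqp : q ≠ p) (hc : All c X)
    (hpn : (sub X p).Nonempty) (hqn : (sub X q).Nonempty) (hpq : All q (sub X p))
    (hqp' : All p (sub X q)) (hcq : All q (sub X c)) : cnt X ≤ 3 ^ (j + 1) + 2 := by
  have h1 := (seeingBounds j).two (sub X p) c q hqc.symm (mv_sub h p) (all_sub hc p) hpq
  have h2 := (seeingBounds j).two (sub X q) c p hcp (mv_sub h q) (all_sub hc q) hqp'
  have hfp := free_comm (all_free hc hcp.symm hpn)
  have hfq := free_comm (all_free hc hqc hqn)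
  rw [cnt_eq_sum hcp hqc hqp, pow_succ]
  rcases direct_or_blocked h hcp hqc hqp with h' | h' | h'
  · have := (seeingBounds j).three (sub X c) c p q hcp hqc.symm hqp.symm (mv_sub h c)
      (all_sub hc c) h'.1 hcq hfp hfq
    omega
  · have h3 := ih.pair hqc hqp (mv_sub h c) (mv_sub h p) hcq hpn h'
    -- For `j = 0` the bound of `pair` is one too large; two free sides cut copy `c` to a single
    -- word instead.
    rcases j with _ | j
    · have := cnt_two_le_of_all_all_free (sub X c) c p q hcp hqc.symm hqp.symm hfp hfq
        (all_sub hc c) hcq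
      omega
    · have := h3.2 (by omega)
      omega
  · exact absurd (all_sub hc p) h'.1

theorem Bounds.succ_one {j : ℕ} (ih : Bounds j) (X : WordSet (j + 1 + 2)) (c : Fin 3) (h : MV X)
    (hc : All c X) : cnt X ≤ 3 ^ (j + 1) + 2 := by
  obtain ⟨p, hpc⟩ := exists_ne c
  obtain ⟨q, hqc, hqp⟩ := exists_third hpc.symm
  by_cases hpn : (sub X p).Nonempty
  swap
  · exact ih.succ_one_of_empty X h hpc.symm hqc hqp hc hpn
  by_cases hqn : (sub X q).Nonempty
  swap
  · exact ih.succ_one_of_empty X h hqc.symm hpc hqp.symm hc hqn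
  rcases direct_or_blocked h hqp.symm hpc.symm hqc.symm with h' | h' | h'
  · by_cases hcq : All q (sub X c)
    · exact ih.succ_one_of_direct X h hpc.symm hqc hqp hc hpn hqn h'.1 h'.2 hcq
    by_cases hcp : All p (sub X c)
    · exact ih.succ_one_of_direct X h hqc.symm hpc hqp.symm hc hqn hpn h'.2 h'.1 hcp
    have hBp : Blocked (sub X c) (sub X p) c p q := by
      rcases direct_or_blocked h hpc.symm hqc hqp with h'' | h'' | h''
      · exact absurd h''.1 hcp
      · exact h''
      · exact absurd (all_sub hc p) h''.1
    have hBq : Blocked (sub X c) (sub X q) c q p := by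
      rcases direct_or_blocked h hqc.symm hpc hqp.symm with h'' | h'' | h''
      · exact absurd h''.1 hcq
      · exact h''
      · exact absurd (all_sub hc q) h''.1
    -- Copy `c` is blocked from both others, which is a `triple`; for `j = 0` its bound is one too
    -- large and the two free sides of copy `c` make up for it.
    rcases j with _ | j
    · have hfp := free_comm (all_free hc hpc hpn)
      have hfq := free_comm (all_free hc hqc hqn)
      have hC := cnt_two_le_of_all_free (sub X c) c p hpc.symm hfp (all_sub hc c) (mv_sub h c)
      obtain ⟨u, hu, hs⟩ := hBp.exists
      have h1 := (ih.near_two (sub X p) q c hqc (mv_sub h p) hBp.all (hBp.near_two hu hs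
        fun h0 => by simp [not_mem_of_free hfq h0] at hu)).1
      have h2 := (ih.near_one (sub X q) p c hpc (mv_sub h q) hBq.all hBq.near).1
      rw [cnt_eq_sum hpc.symm hqc hqp]
      omega
    · have := (ih.triple hpc.symm hqc hqp (mv_sub h c) (mv_sub h p) (mv_sub h q) hpn hqn
        hBp hBq).2 (by omega)
      rw [cnt_eq_sum hpc.symm hqc hqp, pow_succ]
      omega
  · exact ih.succ_one_of_blocked X h hpc.symm hqc hqp hc hpn hqn h'
  · exact ih.succ_one_of_blocked X h hqc.symm hpc hqp.symm hc hqn hpn h'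

/-- The bound when copy `k` is empty and the other two see each other directly. -/
theorem Bounds.succ_any_of_empty {j : ℕ} (ih : Bounds j) (X : WordSet (j + 1 + 2)) (h : MV X)
    {a b k : Fin 3} (hab : a ≠ b) (hka : k ≠ a) (hkb : k ≠ b) (hkn : ¬ (sub X k).Nonempty)
    (hd : (sub X a).Nonempty → (sub X b).Nonempty → All b (sub X a) ∧ All a (sub X b)) :
    cnt X ≤ 2 * 3 ^ j + 4 := by
  rw [cnt_eq_sum hab hka hkb, cnt_sub_eq_zero hkn]
  have h1 := ih.any _ (mv_sub h a)
  have h2 := ih.any _ (mv_sub h b)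
  have hj : 0 < 3 ^ j := by positivity
  by_cases han : (sub X a).Nonempty
  · by_cases hbn : (sub X b).Nonempty
    · have hd' := hd han hbn
      have h3 := ih.one _ b (mv_sub h a) hd'.1
      have h4 := ih.one _ a (mv_sub h b) hd'.2
      omega
    · rw [cnt_sub_eq_zero hbn]; omega
  · rw [cnt_sub_eq_zero han]; omega

/-- Either `X` is smaller than the extremal size, or it splits evenly into small copies. -/
theorem Bounds.succ_any {j : ℕ} (ih : Bounds j) (X : WordSet (j + 1 + 2)) (h : MV X) :
    cnt X ≤ 3 ^ (j + 1) + 3 ∧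
      (1 ≤ j → cnt X ≤ 3 ^ (j + 1) + 2 ∨ ∀ a, cnt (sub X a) ≤ 3 ^ j + 1) := by
  have hj : 0 < 3 ^ j := by positivity
  have hj' : 1 ≤ j → 3 ≤ 3 ^ j := fun h1 => three_pow_le_of_le (i := 1) h1
  by_cases hex : ∃ a b k : Fin 3, a ≠ b ∧ k ≠ a ∧ k ≠ b ∧ (sub X b).Nonempty ∧
      Blocked (sub X a) (sub X b) a b k
  · obtain ⟨a, b, k, hab, hka, hkb, hbn, hB⟩ := hex
    have := ih.succ_any_of_blocked X h hab hka hkb hbn hB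
    exact ⟨this.1, fun h1 => Or.inl (this.2 h1)⟩
  have hd : ∀ {a b : Fin 3}, a ≠ b → (sub X a).Nonempty → (sub X b).Nonempty →
      All b (sub X a) ∧ All a (sub X b) := by
    intro a b hab han hbn
    obtain ⟨k, hka, hkb⟩ := exists_third hab
    rcases direct_or_blocked h hab hka hkb with h' | h' | h'
    · exact h'
    · exact absurd ⟨a, b, k, hab, hka, hkb, hbn, h'⟩ hex
    · exact absurd ⟨b, a, k, hab.symm, hkb, hka, han, h'⟩ hex
  by_cases hne : ∀ a, (sub X a).Nonempty
  · have hF : ∀ a, cnt (sub X a) ≤ 3 ^ j + 1 := by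
      intro a
      obtain ⟨b, hba⟩ := exists_ne a
      obtain ⟨k, hka, hkb⟩ := exists_third hba.symm
      exact (seeingBounds j).two (sub X a) b k hkb.symm (mv_sub h a)
        (hd hba.symm (hne a) (hne b)).1 (hd hka.symm (hne a) (hne k)).1
    refine ⟨?_, fun _ => Or.inr hF⟩
    have h0 := hF 0
    have h1 := hF 1
    have h2 := hF 2
    rw [pow_succ, cnt_eq_sum (a := 0) (b := 1) (k := 2) (by decide) (by decide) (by decide)]
    omega
  · push Not at hne
    obtain ⟨k, hkn⟩ := hne
    obtain ⟨a, hak⟩ := exists_ne k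
    obtain ⟨b, hba, hbk⟩ := exists_third hak
    have := ih.succ_any_of_empty X h hba.symm hak.symm hbk.symm hkn (hd hba.symm)
    rw [pow_succ]
    exact ⟨by omega, fun h1 => Or.inl (by have := hj' h1; omega)⟩

theorem bounds : ∀ j, Bounds j
  | 0 => bounds_zero
  | j + 1 =>
    { any := fun X h => ((bounds j).succ_any X h).1
      one := (bounds j).succ_one
      near_one := fun X k a hka h hk => ((bounds j).succ_near X k a hka h hk).1
      near_two := fun X k a hka h hk => ((bounds j).succ_near X k a hka h hk).2 }

theorem cnt_le {j : ℕ} (X : WordSet (j + 2)) (h : MV X) : cnt X ≤ 3 ^ j + 3 := (bounds j).any X h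

theorem cnt_sub_eq {j : ℕ} (hj : 1 ≤ j) (X : WordSet (j + 1 + 2)) (h : MV X)
    (hX : cnt X = 3 ^ (j + 1) + 3) (a : Fin 3) : cnt (sub X a) = 3 ^ j + 1 := by
  have h1 := (((bounds j).succ_any X h).2 hj).resolve_left (by omega)
  have ha := h1 a
  obtain ⟨b, hba⟩ := exists_ne a
  obtain ⟨k, hka, hkb⟩ := exists_third hba.symm
  have hb := h1 b
  have hk := h1 k
  rw [cnt_eq_sum hba.symm hka hkb, pow_succ] at hX
  omega

/-- A direct pair gives twice `3 ^ j + 2`; a blocked one gives `3 ^ j + 3` plus `3 ^ j + 1`. -/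
theorem cnt_sub_add_le {j : ℕ} (X : WordSet (j + 1 + 2)) (h : MV X) {a b : Fin 3} (hab : a ≠ b) :
    cnt (sub X a) + cnt (sub X b) ≤ 2 * 3 ^ j + 4 := by
  have ih := bounds j
  have hj : 0 < 3 ^ j := by positivity
  obtain ⟨k, hka, hkb⟩ := exists_third hab
  have h1 := ih.any _ (mv_sub h a)
  have h2 := ih.any _ (mv_sub h b)
  by_cases han : (sub X a).Nonempty
  swap
  · rw [cnt_sub_eq_zero han]; omega
  by_cases hbn : (sub X b).Nonempty
  swap
  · rw [cnt_sub_eq_zero hbn]; omega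
  rcases direct_or_blocked h hab hka hkb with h' | h' | h'
  · have h3 := ih.one _ b (mv_sub h a) h'.1
    have h4 := ih.one _ a (mv_sub h b) h'.2
    omega
  · have := (ih.near_one _ k a hka (mv_sub h b) h'.all h'.near).1
    omega
  · have := (ih.near_one _ k b hkb (mv_sub h a) h'.all h'.near).1
    omega

end WordSet

-- Distances and shortest walks

/-- The extreme vertex `c…c`. -/
def Word.corner (c : Fin 3) : ∀ n, Word n
  | 0 => ()
  | n + 1 => (c, Word.corner c n)

/-- Adjacency in the Sierpiński graph, by recursion on the length of the words. -/
def Word.Adj : ∀ {n}, Word n → Word n → Prop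
  | 0, _, _ => False
  | n + 1, u, v => (u.1 = v.1 ∧ Word.Adj (n := n) u.2 v.2) ∨
      (u.1 ≠ v.1 ∧ u.2 = Word.corner v.1 n ∧ v.2 = Word.corner u.1 n)

theorem Word.Adj.symm : ∀ {n} {u v : Word n}, Word.Adj u v → Word.Adj v u
  | 0, _, _, h => h
  | _ + 1, _, _, h => h.imp (fun h => ⟨h.1.symm, h.2.symm⟩) (fun h => ⟨h.1.symm, h.2.2, h.2.1⟩)

theorem Word.Adj.irrefl : ∀ {n} {u : Word n}, ¬ Word.Adj u u
  | 0, _, h => h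
  | _ + 1, _, h => h.elim (fun h => h.2.irrefl) (fun h => h.1 rfl)

/-- The Sierpiński graph `S_3^n` on nested words. -/
def wordGraph (n : ℕ) : SimpleGraph (Word n) where
  Adj := Word.Adj
  symm := ⟨fun _ _ h => h.symm⟩
  loopless := ⟨fun _ h => h.irrefl⟩

/-- The inclusion of the copy with first letter `a`. -/
def copyHom (n : ℕ) (a : Fin 3) : wordGraph n →g wordGraph (n + 1) where
  toFun u := (a, u)
  map_rel' h := Or.inl ⟨rfl, h⟩

namespace WordSet

open Word (corner)

variable {n : ℕ}

theorem adj_corner {a b : Fin 3} (hab : a ≠ b) :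
    (wordGraph (n + 1)).Adj (a, corner b n) (b, corner a n) := Or.inr ⟨hab, rfl, rfl⟩

@[simp] theorem dc_corner_self (c : Fin 3) : ∀ n, dc c (corner c n) = 0
  | 0 => rfl
  | n + 1 => by simp [corner, dc_corner_self c n]

theorem dc_corner {b c : Fin 3} (hbc : b ≠ c) : ∀ n, dc c (corner b n) + 1 = 2 ^ n
  | 0 => rfl
  | n + 1 => by
    have := dc_corner hbc n
    simp only [corner, dc_cons, if_neg hbc, pow_succ]
    omega

/-- The distance between two words. -/
def wordDist : ∀ {n}, Word n → Word n → ℕ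
  | 0, _, _ => 0
  | n + 1, u, v =>
    if u.1 = v.1 then wordDist (n := n) u.2 v.2 else
      min (dc (n := n) v.1 u.2 + 1 + dc (n := n) u.1 v.2)
        (dc (n := n) (third u.1 v.1) u.2 + 1 + 2 ^ n + dc (n := n) (third u.1 v.1) v.2)

theorem wordDist_cons_self (a : Fin 3) (u v : Word n) :
    wordDist (n := n + 1) (a, u) (a, v) = wordDist u v := by
  simp [wordDist]

theorem wordDist_cons {a b k : Fin 3} (hab : a ≠ b) (hka : k ≠ a) (hkb : k ≠ b) (u v : Word n) :
    wordDist (n := n + 1) (a, u) (b, v) =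
      min (dc b u + 1 + dc a v) (dc k u + 1 + 2 ^ n + dc k v) := by
  simp [wordDist, hab, third_eq hab hka hkb]

theorem wordDist_self : ∀ {n} (u : Word n), wordDist u u = 0
  | 0, _ => rfl
  | _ + 1, (a, u) => by rw [wordDist_cons_self, wordDist_self]

theorem wordDist_lt : ∀ {n} (u v : Word n), wordDist u v + 1 ≤ 2 ^ n
  | 0, _, _ => le_rfl
  | n + 1, (a, u), (b, v) => by
    by_cases hab : a = b
    · subst hab
      have := wordDist_lt u v
      rw [wordDist_cons_self, pow_succ]
      omega
    · obtain ⟨k, hka, hkb⟩ := exists_third hab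
      have := dc_lt b u
      have := dc_lt a v
      rw [wordDist_cons hab hka hkb, pow_succ]
      omega

theorem wordDist_corner (c : Fin 3) : ∀ {n} (u : Word n), wordDist u (corner c n) = dc c u
  | 0, _ => rfl
  | n + 1, (a, u) => by
    by_cases hac : a = c
    · subst hac
      simp [corner, wordDist_cons_self, wordDist_corner]
    · obtain ⟨k, hka, hkc⟩ := exists_third hac
      have h1 := dc_corner (Ne.symm hac) n
      have h2 := dc_corner hkc.symm n
      have := dc_lt c u
      rw [corner, wordDist_cons hac hka hkc, dc_cons, if_neg hac]
      omega

theorem dc_adj_le (c : Fin 3) : ∀ {n} {u v : Word n}, Word.Adj u v → dc c v ≤ dc c u + 1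
  | 0, _, _, h => h.elim
  | n + 1, (a, u), (b, v), h => by
    obtain ⟨hab, h⟩ | ⟨hab, hu, hv⟩ := h
    · obtain rfl : a = b := hab
      replace h : Word.Adj u v := h
      have := dc_adj_le c h
      simp only [dc_cons]
      omega
    · replace hab : a ≠ b := hab
      obtain rfl : u = corner b n := hu
      obtain rfl : v = corner a n := hv
      rw [dc_cons, dc_cons]
      by_cases hac : a = c
      · subst hac
        have := dc_corner hab.symm n
        simp [hab.symm]
        omega
      · by_cases hbc : b = c
        · subst hbc
          have := dc_corner hab n
          simp [hac]
          omega
        · have := dc_corner hac n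
          have := dc_corner hbc n
          simp [hac, hbc]
          omega

/-- The formula changes by at most one along an edge, so it bounds the length of every walk from
below; explicit walks attain it. -/
theorem wordDist_adj_le : ∀ {n} (u : Word n) {x y : Word n}, Word.Adj x y →
    wordDist u y ≤ wordDist u x + 1
  | 0, _, _, _, h => h.elim
  | n + 1, (a, u), (b, x), (c, y), h => by
    obtain ⟨hbc, h⟩ | ⟨hbc, hx, hy⟩ := h
    · obtain rfl : b = c := hbc
      replace h : Word.Adj x y := h
      by_cases hab : a = b
      · subst hab
        rw [wordDist_cons_self, wordDist_cons_self]
        exact wordDist_adj_le u h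
      · obtain ⟨k, hka, hkb⟩ := exists_third hab
        have := dc_adj_le a h
        have := dc_adj_le k h
        rw [wordDist_cons hab hka hkb, wordDist_cons hab hka hkb]
        omega
    · replace hbc : b ≠ c := hbc
      obtain rfl : x = corner c n := hx
      obtain rfl : y = corner b n := hy
      obtain ⟨k, hkb, hkc⟩ := exists_third hbc
      rcases eq_of_ne hbc hkb hkc a with rfl | rfl | rfl
      · rw [wordDist_cons hbc hkb hkc, wordDist_cons_self, wordDist_corner, dc_corner_self]
        omega
      · rw [wordDist_cons hbc.symm hkc hkb, wordDist_cons_self, wordDist_corner, dc_corner_self]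
        have := dc_lt b u
        have := dc_corner hkb.symm n
        omega
      · have := dc_corner hkb.symm n
        have := dc_corner hkc.symm n
        rw [wordDist_cons hkb hkc.symm hbc.symm, wordDist_cons hkc hkb.symm hbc, dc_corner_self,
          dc_corner_self]
        omega

theorem wordDist_le_length (u : Word n) {x y : Word n} (p : (wordGraph n).Walk x y) :
    wordDist u y ≤ wordDist u x + p.length := by
  induction p with
  | nil => simp
  | cons h p ih =>
    have := wordDist_adj_le u h
    simp only [SimpleGraph.Walk.length_cons]
    omega

theorem wordDist_le {u v : Word n} (p : (wordGraph n).Walk u v) : wordDist u v ≤ p.length := by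
  simpa [wordDist_self] using wordDist_le_length u p

theorem exists_walk_join {V : Type*} {G : SimpleGraph V} {x s t y : V} (p : G.Walk x s)
    (q : G.Walk t y) (h : G.Adj s t) : ∃ r : G.Walk x y, r.length = p.length + 1 + q.length ∧
      ∀ w ∈ r.support, w ∈ p.support ∨ w ∈ q.support := by
  refine ⟨p.append (.cons h q), by simp; omega, fun w hw => ?_⟩
  rw [SimpleGraph.Walk.mem_support_append_iff, SimpleGraph.Walk.support_cons] at hw
  rcases hw with hw | hw
  · exact Or.inl hw
  · rcases List.mem_cons.1 hw with rfl | hw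
    · exact Or.inl p.end_mem_support
    · exact Or.inr hw

theorem exists_walk_copy {u v : Word n} (a : Fin 3) (p : (wordGraph n).Walk u v) :
    ∃ q : (wordGraph (n + 1)).Walk (a, u) (a, v), q.length = p.length ∧
      ∀ w ∈ q.support, w.1 = a ∧ w.2 ∈ p.support := by
  refine ⟨p.map (copyHom n a), SimpleGraph.Walk.length_map (copyHom n a) p, fun w hw => ?_⟩
  replace hw := (SimpleGraph.Walk.support_map (copyHom n a) p) ▸ hw
  rw [List.mem_map] at hw
  obtain ⟨z, hz, rfl⟩ := hw
  exact ⟨rfl, hz⟩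

theorem exists_walk_of_free {a b : Fin 3} (hab : a ≠ b) : ∀ {n} {X : WordSet n}, Free a b X →
    ∃ p : (wordGraph n).Walk (corner a n) (corner b n), p.length + 1 = 2 ^ n ∧
      ∀ w ∈ p.support, X w = false
  | 0, X, h => ⟨.nil, rfl, fun _ _ => h⟩
  | n + 1, X, h => by
    change ∃ p : (wordGraph (n + 1)).Walk (a, corner a n) (b, corner b n),
      p.length + 1 = 2 ^ (n + 1) ∧ ∀ w ∈ p.support, X w = false
    obtain ⟨p, hp, hpX⟩ := exists_walk_of_free hab h.1
    obtain ⟨q, hq, hqX⟩ := exists_walk_of_free hab h.2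
    obtain ⟨p', hp', hpX'⟩ := exists_walk_copy a p
    obtain ⟨q', hq', hqX'⟩ := exists_walk_copy b q
    obtain ⟨r, hr, hrX⟩ := exists_walk_join p' q' (adj_corner hab)
    refine ⟨r, by rw [pow_succ]; omega, fun w hw => ?_⟩
    obtain ⟨c, w⟩ := w
    rcases hrX _ hw with hw | hw
    · obtain ⟨rfl, h'⟩ := hpX' _ hw
      exact hpX _ h'
    · obtain ⟨rfl, h'⟩ := hqX' _ hw
      exact hqX _ h'

theorem exists_walk_of_sees {c : Fin 3} : ∀ {n} {X : WordSet n} {u : Word n}, Sees c X u →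
    ∃ p : (wordGraph n).Walk u (corner c n), p.length = dc c u ∧
      ∀ w ∈ p.support, X w = true → w = u
  | 0, X, _, _ => ⟨.nil, rfl, fun _ _ _ => rfl⟩
  | n + 1, X, (a, u), h => by
    change ∃ p : (wordGraph (n + 1)).Walk (a, u) (c, corner c n),
      p.length = dc c (n := n + 1) (a, u) ∧ ∀ w ∈ p.support, X w = true → w = (a, u)
    obtain ⟨h1, h2⟩ := sees_cons.1 h
    obtain ⟨p, hp, hpX⟩ := exists_walk_of_sees h1
    obtain ⟨p', hp', hpX'⟩ := exists_walk_copy a p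
    by_cases hac : a = c
    · subst hac
      refine ⟨p', by simp [hp', hp], fun w hw hX => ?_⟩
      obtain ⟨c, w⟩ := w
      obtain ⟨rfl, h'⟩ := hpX' _ hw
      exact Prod.ext rfl (hpX _ h' hX)
    · obtain ⟨q, hq, hqX⟩ := exists_walk_of_free hac (h2.resolve_left hac)
      obtain ⟨q', hq', hqX'⟩ := exists_walk_copy c q
      obtain ⟨r, hr, hrX⟩ := exists_walk_join p' q' (adj_corner hac)
      refine ⟨r, by rw [dc_cons, if_neg hac]; omega, fun w hw hX => ?_⟩
      obtain ⟨x, w⟩ := w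
      rcases hrX _ hw with hw | hw
      · obtain ⟨rfl, h'⟩ := hpX' _ hw
        exact Prod.ext rfl (hpX _ h' hX)
      · obtain ⟨rfl, h'⟩ := hqX' _ hw
        have := hqX _ h'
        simp_all [sub]

theorem exists_walk_of_vis : ∀ {n} {X : WordSet n} {u v : Word n}, Vis X u v →
    ∃ p : (wordGraph n).Walk u v, p.length = wordDist u v ∧
      ∀ w ∈ p.support, X w = true → w = u ∨ w = v
  | 0, _, _, _, _ => ⟨.nil, rfl, fun _ _ _ => Or.inl rfl⟩
  | n + 1, X, (a, u), (b, v), h => by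
    by_cases hab : a = b
    · subst hab
      obtain ⟨p, hp, hpX⟩ := exists_walk_of_vis (vis_cons_self.1 h)
      obtain ⟨p', hp', hpX'⟩ := exists_walk_copy a p
      refine ⟨p', by rw [wordDist_cons_self, hp', hp], fun w hw hX => ?_⟩
      obtain ⟨c, w⟩ := w
      obtain ⟨rfl, h'⟩ := hpX' _ hw
      exact (hpX _ h' hX).imp (Prod.ext rfl) (Prod.ext rfl)
    obtain ⟨k, hka, hkb⟩ := exists_third hab
    rcases (vis_cons hab hka hkb).1 h with ⟨hle, h1, h2⟩ | ⟨hle, h1, h2, h3⟩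
    · obtain ⟨p, hp, hpX⟩ := exists_walk_of_sees h1
      obtain ⟨q, hq, hqX⟩ := exists_walk_of_sees h2
      obtain ⟨p', hp', hpX'⟩ := exists_walk_copy a p
      obtain ⟨q', hq', hqX'⟩ := exists_walk_copy b q.reverse
      obtain ⟨r, hr, hrX⟩ := exists_walk_join p' q' (adj_corner hab)
      rw [SimpleGraph.Walk.length_reverse] at hq'
      refine ⟨r, by rw [wordDist_cons hab hka hkb]; omega, fun w hw hX => ?_⟩
      obtain ⟨x, w⟩ := w
      rcases hrX _ hw with hw | hw
      · obtain ⟨rfl, h'⟩ := hpX' _ hw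
        exact Or.inl (Prod.ext rfl (hpX _ h' hX))
      · obtain ⟨rfl, h'⟩ := hqX' _ hw
        exact Or.inr (Prod.ext rfl (hqX _ (by simpa using h') hX))
    · obtain ⟨p, hp, hpX⟩ := exists_walk_of_sees h1
      obtain ⟨q, hq, hqX⟩ := exists_walk_of_sees h2
      obtain ⟨m, hm, hmX⟩ := exists_walk_of_free hab h3
      obtain ⟨p', hp', hpX'⟩ := exists_walk_copy a p
      obtain ⟨q', hq', hqX'⟩ := exists_walk_copy b q.reverse
      obtain ⟨m', hm', hmX'⟩ := exists_walk_copy k m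
      obtain ⟨s, hs, hsX⟩ := exists_walk_join p' m' (adj_corner hka.symm)
      obtain ⟨r, hr, hrX⟩ := exists_walk_join s q' (adj_corner hkb)
      rw [SimpleGraph.Walk.length_reverse] at hq'
      refine ⟨r, by rw [wordDist_cons hab hka hkb]; omega, fun w hw hX => ?_⟩
      obtain ⟨x, w⟩ := w
      rcases hrX _ hw with hw | hw
      · rcases hsX _ hw with hw | hw
        · obtain ⟨rfl, h'⟩ := hpX' _ hw
          exact Or.inl (Prod.ext rfl (hpX _ h' hX))
        · obtain ⟨rfl, h'⟩ := hmX' _ hw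
          have := hmX _ h'
          simp_all [sub]
      · obtain ⟨rfl, h'⟩ := hqX' _ hw
        exact Or.inr (Prod.ext rfl (hqX _ (by simpa using h') hX))

theorem free_empty {a b : Fin 3} : ∀ {n}, Free a b (fun _ : Word n => false)
  | 0 => rfl
  | _ + 1 => ⟨free_empty, free_empty⟩

theorem sees_empty (c : Fin 3) : ∀ {n} (u : Word n), Sees c (fun _ => false) u
  | 0, _ => trivial
  | _ + 1, u => ⟨sees_empty c u.2, Or.inr free_empty⟩

theorem vis_empty : ∀ {n} (u v : Word n), Vis (fun _ => false) u v
  | 0, _, _ => trivial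
  | n + 1, (a, u), (b, v) => by
    by_cases hab : a = b
    · subst hab
      exact vis_cons_self.2 (vis_empty u v)
    · obtain ⟨k, hka, hkb⟩ := exists_third hab
      rw [vis_cons hab hka hkb]
      exact (le_total _ _).imp (fun h => ⟨h, sees_empty _ _, sees_empty _ _⟩)
        (fun h => ⟨h, sees_empty _ _, sees_empty _ _, free_empty⟩)

theorem wordDist_triangle (c : Fin 3) (u v : Word n) : wordDist u v ≤ dc c u + dc c v := by
  obtain ⟨p, hp, -⟩ := exists_walk_of_sees (sees_empty c u)
  obtain ⟨q, hq, -⟩ := exists_walk_of_sees (sees_empty c v)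
  have := wordDist_le (p.append q.reverse)
  simp only [SimpleGraph.Walk.length_append, SimpleGraph.Walk.length_reverse] at this
  omega

/-- Cuts a walk at an edge leaving `S`. The pieces are not claimed to stay on their side; length
comparison confines them to copies later. -/
theorem exists_crossing {V : Type*} {G : SimpleGraph V} (S : V → Prop) {x y : V}
    (p : G.Walk x y) (hx : S x) (hy : ¬ S y) :
    ∃ (s t : V) (q : G.Walk x s) (r : G.Walk t y), S s ∧ ¬ S t ∧ G.Adj s t ∧
      p.length = q.length + 1 + r.length ∧ q.support ⊆ p.support ∧ r.support ⊆ p.support := by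
  induction p with
  | nil => exact absurd hx hy
  | @cons u v w h p ih =>
    by_cases hv : S v
    · obtain ⟨s, t, q, r, hs, ht, hst, hl, hq, hr⟩ := ih hv hy
      refine ⟨s, t, .cons h q, r, hs, ht, hst, by simp; omega, ?_, ?_⟩
      · simp only [SimpleGraph.Walk.support_cons]
        exact List.cons_subset_cons _ hq
      · simp only [SimpleGraph.Walk.support_cons]
        exact List.subset_cons_of_subset _ hr
    · exact ⟨u, v, .nil, p, hx, hv, h, by simp; omega, by simp, by simp⟩

theorem exists_walk_of_forall_copy {a : Fin 3} {x y : Word (n + 1)}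
    (q : (wordGraph (n + 1)).Walk x y) (h : ∀ w ∈ q.support, w.1 = a) :
    ∃ p : (wordGraph n).Walk x.2 y.2, p.length = q.length ∧
      ∀ w ∈ p.support, (a, w) ∈ q.support := by
  induction q with
  | nil =>
    refine ⟨.nil, rfl, fun w hw => ?_⟩
    simp only [SimpleGraph.Walk.support_nil, List.mem_singleton] at hw h ⊢
    exact Prod.ext (h _ rfl).symm hw
  | @cons u v w hadj q ih =>
    simp only [SimpleGraph.Walk.support_cons, List.mem_cons, forall_eq_or_imp] at h
    obtain ⟨p, hp, hps⟩ := ih h.2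
    have hv := h.2 v q.start_mem_support
    have hadj' : (wordGraph n).Adj u.2 v.2 :=
      (hadj.resolve_right fun h' => h'.1 (h.1.trans hv.symm)).2
    refine ⟨.cons hadj' p, by simp [hp], fun z hz => ?_⟩
    simp only [SimpleGraph.Walk.support_cons, List.mem_cons] at hz ⊢
    exact hz.imp (fun h' => Prod.ext h.1.symm h') (hps z)

/-- Shortest walks between words of one copy stay in that copy. -/
theorem exists_walk_of_copy {a : Fin 3} {u v : Word n}
    (q : (wordGraph (n + 1)).Walk (a, u) (a, v)) (h : q.length ≤ wordDist u v) :
    ∃ p : (wordGraph n).Walk u v, p.length ≤ wordDist u v ∧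
      ∀ w ∈ p.support, (a, w) ∈ q.support := by
  obtain ⟨p, hp, hps⟩ := exists_walk_of_forall_copy (a := a) q fun t ht => by
    obtain ⟨b, t⟩ := t
    by_contra hba
    have hab : a ≠ b := Ne.symm hba
    obtain ⟨k, hka, hkb⟩ := exists_third hab
    have h1 := wordDist_le (q.takeUntil _ ht)
    have h2 := wordDist_le (q.dropUntil _ ht)
    have h3 := congrArg SimpleGraph.Walk.length (q.take_spec ht)
    rw [SimpleGraph.Walk.length_append] at h3
    -- A visit to copy `b` is too long: if both legs use the same kind of path, the triangle
    -- inequality through a corner leaves an excess of at least 2, and mixed legs already cost more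
    -- than `2 ^ n`.
    rw [wordDist_cons hab hka hkb] at h1
    rw [wordDist_cons hab.symm hkb hka] at h2
    have h4 := wordDist_triangle b u v
    have h5 := wordDist_triangle k u v
    have h6 := wordDist_lt u v
    omega
  exact ⟨p, hp ▸ h, hps⟩

theorem adj_of_ne {a b : Fin 3} (hab : a ≠ b) {u v : Word n}
    (h : (wordGraph (n + 1)).Adj (a, u) (b, v)) : u = corner b n ∧ v = corner a n :=
  (h.resolve_left fun h => hab h.1).2

/-- Shortest walks between two copies. -/
theorem exists_walks_of_ne {a b k : Fin 3} (hab : a ≠ b) (hka : k ≠ a) (hkb : k ≠ b)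
    {u v : Word n} (p : (wordGraph (n + 1)).Walk (a, u) (b, v))
    (h : p.length ≤ wordDist (n := n + 1) (a, u) (b, v)) :
    (dc b u + dc a v ≤ dc k u + 2 ^ n + dc k v ∧
      (∃ q : (wordGraph n).Walk u (corner b n), q.length ≤ dc b u ∧
        ∀ w ∈ q.support, (a, w) ∈ p.support) ∧
      ∃ r : (wordGraph n).Walk v (corner a n), r.length ≤ dc a v ∧
        ∀ w ∈ r.support, (b, w) ∈ p.support) ∨
    (dc k u + 2 ^ n + dc k v ≤ dc b u + dc a v ∧
      (∃ q : (wordGraph n).Walk u (corner k n), q.length ≤ dc k u ∧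
        ∀ w ∈ q.support, (a, w) ∈ p.support) ∧
      (∃ r : (wordGraph n).Walk v (corner k n), r.length ≤ dc k v ∧
        ∀ w ∈ r.support, (b, w) ∈ p.support) ∧
      ∃ m : (wordGraph n).Walk (corner a n) (corner b n), m.length + 1 ≤ 2 ^ n ∧
        ∀ w ∈ m.support, (k, w) ∈ p.support) := by
  have pull : ∀ {x : Fin 3} {y z : Word n} (s : (wordGraph (n + 1)).Walk (x, y) (x, z)),
      s.support ⊆ p.support → s.length ≤ wordDist y z →
      ∃ t : (wordGraph n).Walk y z, t.length ≤ wordDist y z ∧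
        ∀ w ∈ t.support, (x, w) ∈ p.support := by
    intro x y z s hs hl
    obtain ⟨t, ht, hts⟩ := exists_walk_of_copy s hl
    exact ⟨t, ht, fun w hw => hs (hts w hw)⟩
  rw [wordDist_cons hab hka hkb] at h
  obtain ⟨⟨a', s⟩, ⟨x, t⟩, q, r, hs, ht, hadj, hl, hq, hr⟩ :=
    exists_crossing (fun w : Word (n + 1) => w.1 = a) p rfl (Ne.symm hab)
  obtain rfl : a' = a := hs
  have hxa : x ≠ a' := ht
  obtain ⟨rfl, rfl⟩ := adj_of_ne hxa.symm hadj
  have hq1 := wordDist_le q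
  rw [wordDist_cons_self, wordDist_corner] at hq1
  rcases eq_of_ne hab hka hkb x with rfl | rfl | rfl
  · exact absurd rfl hxa
  · have hr1 := wordDist_le r.reverse
    rw [wordDist_cons_self, wordDist_corner, SimpleGraph.Walk.length_reverse] at hr1
    refine Or.inl ⟨by omega, ?_, ?_⟩
    · simpa only [wordDist_corner] using pull q hq (by rw [wordDist_corner]; omega)
    · simpa only [wordDist_corner] using pull r.reverse (by simpa using hr)
        (by rw [wordDist_corner, SimpleGraph.Walk.length_reverse]; omega)
  · obtain ⟨⟨y, s⟩, ⟨b', t⟩, m, r', hs, ht, hadj', hl', hm, hr'⟩ :=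
      exists_crossing (fun w : Word (n + 1) => w.1 ≠ b) r hkb (by simp)
    have hyb : y ≠ b := hs
    obtain rfl : b' = b := by simpa using ht
    obtain ⟨rfl, rfl⟩ := adj_of_ne hyb hadj'
    have hm1 := wordDist_le m
    have hr1 := wordDist_le r'.reverse
    rw [wordDist_cons_self, wordDist_corner, SimpleGraph.Walk.length_reverse] at hr1
    have hc1 := dc_corner hab n
    rcases eq_of_ne hab hka hkb y with rfl | rfl | rfl
    -- Returning from copy `k` to copy `a` before entering copy `b` costs a full side, more than the
    -- direct path.
    · rw [wordDist_cons hka hkb.symm hab.symm, dc_corner_self] at hm1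
      have := dc_corner hkb.symm n
      have := dc_lt b' u
      omega
    · exact absurd rfl hyb
    · rw [wordDist_cons_self, wordDist_corner] at hm1
      refine Or.inr ⟨by omega, ?_, ?_, ?_⟩
      · simpa only [wordDist_corner] using pull q hq (by rw [wordDist_corner]; omega)
      · simpa only [wordDist_corner] using pull r'.reverse
          (by simpa using List.Subset.trans hr' hr)
          (by rw [wordDist_corner, SimpleGraph.Walk.length_reverse]; omega)
      · obtain ⟨m', hm', hms⟩ := pull m (List.Subset.trans hm hr)
          (by rw [wordDist_corner]; omega)
        rw [wordDist_corner] at hm'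
        exact ⟨m', by omega, hms⟩

theorem free_of_walk {a b : Fin 3} (hab : a ≠ b) : ∀ {n} {X : WordSet n}
    (p : (wordGraph n).Walk (corner a n) (corner b n)), p.length + 1 ≤ 2 ^ n →
    (∀ w ∈ p.support, X w = false) → Free a b X
  | 0, _, p, _, h => h _ p.start_mem_support
  | n + 1, X, p, hp, h => by
    obtain ⟨k, hka, hkb⟩ := exists_third hab
    change (wordGraph (n + 1)).Walk (a, corner a n) (b, corner b n) at p
    change p.length + 1 ≤ 2 ^ (n + 1) at hp
    change ∀ w ∈ p.support, X w = false at h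
    have h1 := dc_corner hab n
    have h2 := dc_corner hab.symm n
    have h3 := dc_corner hka.symm n
    have h4 := dc_corner hkb.symm n
    rw [pow_succ] at hp
    rcases exists_walks_of_ne hab hka hkb p
      (by rw [wordDist_cons hab hka hkb]; omega) with
      ⟨-, ⟨q, hq, hqs⟩, r, hr, hrs⟩ | ⟨hle, -⟩
    · exact ⟨free_of_walk hab q (by omega) fun w hw => h _ (hqs w hw),
        free_of_walk hab r.reverse (by rw [SimpleGraph.Walk.length_reverse]; omega)
          fun w hw => h _ (hrs w (by simpa using hw))⟩
    · omega

theorem sees_of_walk {c : Fin 3} : ∀ {n} {X : WordSet n} {u : Word n}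
    (p : (wordGraph n).Walk u (corner c n)), p.length ≤ dc c u →
    (∀ w ∈ p.support, X w = true → w = u) → Sees c X u
  | 0, _, _, _, _, _ => trivial
  | n + 1, X, (a, u), p, hp, h => by
    change (wordGraph (n + 1)).Walk (a, u) (c, corner c n) at p
    change p.length ≤ dc c (n := n + 1) (a, u) at hp
    change ∀ w ∈ p.support, X w = true → w = (a, u) at h
    by_cases hac : a = c
    · subst hac
      obtain ⟨q, hq, hqs⟩ := exists_walk_of_copy p
        (by rw [wordDist_corner]; simpa using hp)
      rw [wordDist_corner] at hq
      exact ⟨sees_of_walk q hq fun w hw hX => (Prod.ext_iff.1 (h _ (hqs w hw) hX)).2, Or.inl rfl⟩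
    · obtain ⟨k, hka, hkc⟩ := exists_third hac
      have h1 := dc_corner hac n
      have h2 := dc_corner (Ne.symm hac) n
      have h4 := dc_corner hkc.symm n
      have h5 := dc_lt c u
      rw [dc_cons, if_neg hac] at hp
      rcases exists_walks_of_ne hac hka hkc p
        (by rw [wordDist_cons hac hka hkc]; omega) with
        ⟨-, ⟨q, hq, hqs⟩, r, hr, hrs⟩ | ⟨hle, -⟩
      · refine ⟨sees_of_walk q hq fun w hw hX => (Prod.ext_iff.1 (h _ (hqs w hw) hX)).2,
          Or.inr (free_of_walk hac r.reverse (by rw [SimpleGraph.Walk.length_reverse]; omega)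
            fun w hw => ?_)⟩
        by_contra hX
        exact hac (Prod.ext_iff.1 (h (c, w) (hrs w (by simpa using hw))
          (by simpa [sub] using hX))).1.symm
      · omega

theorem vis_of_walk : ∀ {n} {X : WordSet n} {u v : Word n} (p : (wordGraph n).Walk u v),
    p.length ≤ wordDist u v → (∀ w ∈ p.support, X w = true → w = u ∨ w = v) → Vis X u v
  | 0, _, _, _, _, _, _ => trivial
  | n + 1, X, (a, u), (b, v), p, hp, h => by
    by_cases hab : a = b
    · subst hab
      rw [wordDist_cons_self] at hp
      obtain ⟨q, hq, hqs⟩ := exists_walk_of_copy p hp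
      exact vis_cons_self.2 (vis_of_walk q hq fun w hw hX =>
        (h _ (hqs w hw) hX).imp (fun h => (Prod.ext_iff.1 h).2) (fun h => (Prod.ext_iff.1 h).2))
    · obtain ⟨k, hka, hkb⟩ := exists_third hab
      have ha : ∀ w, (a, w) ∈ p.support → sub X a w = true → w = u := fun w hw hX =>
        (h _ hw hX).elim (fun h => (Prod.ext_iff.1 h).2) (fun h => absurd (Prod.ext_iff.1 h).1 hab)
      have hb : ∀ w, (b, w) ∈ p.support → sub X b w = true → w = v := fun w hw hX =>
        (h _ hw hX).elim (fun h => absurd (Prod.ext_iff.1 h).1.symm hab)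
          (fun h => (Prod.ext_iff.1 h).2)
      rw [vis_cons hab hka hkb]
      rcases exists_walks_of_ne hab hka hkb p hp with
        ⟨hle, ⟨q, hq, hqs⟩, r, hr, hrs⟩ | ⟨hle, ⟨q, hq, hqs⟩, ⟨r, hr, hrs⟩, m, hm, hms⟩
      · exact Or.inl ⟨hle, sees_of_walk q hq fun w hw => ha w (hqs w hw),
          sees_of_walk r hr fun w hw => hb w (hrs w hw)⟩
      · refine Or.inr ⟨hle, sees_of_walk q hq fun w hw => ha w (hqs w hw),
          sees_of_walk r hr fun w hw => hb w (hrs w hw), free_of_walk hab m hm fun w hw => ?_⟩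
        by_contra hX
        rcases h (k, w) (hms w hw) (by simpa [sub] using hX) with h' | h'
        · exact hka (Prod.ext_iff.1 h').1
        · exact hkb (Prod.ext_iff.1 h').1

end WordSet

-- The extremal sets

namespace WordSet

open Word (corner)

variable {n : ℕ}

/-- The words ending in `012`, `120` or `201`. -/
def core : ∀ j, WordSet (j + 3)
  | 0 => fun u => decide (u = (0, 1, 2, ()) ∨ u = (1, 2, 0, ()) ∨ u = (2, 0, 1, ()))
  | j + 1 => fun u => core j u.2

/-- The set `core j` together with the extreme vertices `c…c` with `S c`. -/
def coreWith (S : Fin 3 → Bool) (j : ℕ) : WordSet (j + 3) :=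
  fun u => core j u || decide (∃ c, S c = true ∧ u = corner c (j + 3))

/-- A corner lies only in the copy of its own letter. Letting `S` vary is what makes the family
closed under passing to copies. -/
theorem sub_coreWith (S : Fin 3 → Bool) (j : ℕ) (a : Fin 3) :
    sub (coreWith S (j + 1)) a = coreWith (fun c => S c && decide (c = a)) j := by
  funext u
  rw [Bool.eq_iff_iff]
  have h : ∀ c, ((a, u) : Word (j + 1 + 3)) = corner c (j + 1 + 3) ↔ a = c ∧ u = corner c (j + 3) :=
    fun c => Prod.ext_iff
  simp only [sub, coreWith, core, Bool.or_eq_true, decide_eq_true_eq, Bool.and_eq_true, h]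
  refine or_congr_right (exists_congr fun c => ?_)
  rw [eq_comm (a := a)]
  tauto

/-- The visibility properties that carry over from `coreWith · j` to `coreWith · (j + 1)`. -/
theorem coreWith_visible : ∀ j, (∀ S, MV (coreWith S j)) ∧
    (∀ S b, S b = false → All b (coreWith S j)) ∧
    ∀ S b c, b ≠ c → S b = false → S c = false → Free b c (coreWith S j)
  | 0 => by
    refine ⟨?_, ?_, ?_⟩ <;> decide +kernel
  | j + 1 => by
    obtain ⟨hM, hA, hF⟩ := coreWith_visible j
    refine ⟨?_, ?_, ?_⟩
    · rintro S ⟨a, u⟩ ⟨b, v⟩ hu hv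
      by_cases hab : a = b
      · subst hab
        rw [vis_cons_self]
        have h := hM (fun c => S c && decide (c = a))
        rw [← sub_coreWith] at h
        exact h u v hu hv
      · obtain ⟨k, hka, hkb⟩ := exists_third hab
        have hA' : ∀ x y, x ≠ y → All y (sub (coreWith S (j + 1)) x) := by
          intro x y hxy
          rw [sub_coreWith]
          exact hA _ _ (by simp [hxy.symm])
        have hf : Free a b (sub (coreWith S (j + 1)) k) := by
          rw [sub_coreWith]
          exact hF _ _ _ hab (by simp [hka.symm]) (by simp [hkb.symm])
        rw [vis_cons hab hka hkb]
        -- Both the direct path and the detour are clear, so whichever is shorter serves.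
        exact (le_total _ _).imp (fun h => ⟨h, hA' a b hab u hu, hA' b a (Ne.symm hab) v hv⟩)
          fun h => ⟨h, hA' a k hka.symm u hu, hA' b k hkb.symm v hv, hf⟩
    · rintro S b hb ⟨a, u⟩ hu
      have h := hA (fun c => S c && decide (c = a)) b (by simp [hb])
      rw [← sub_coreWith] at h
      refine sees_cons.2 ⟨h u hu, ?_⟩
      by_cases hab : a = b
      · exact Or.inl hab
      · rw [sub_coreWith]
        exact Or.inr (hF _ _ _ hab (by simp [hab]) (by simp [hb]))
    · intro S b c hbc hb hc
      constructor
      · rw [sub_coreWith]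
        exact hF _ _ _ hbc (by simp [hb]) (by simp [hc])
      · rw [sub_coreWith]
        exact hF _ _ _ hbc (by simp [hb]) (by simp [hc])

theorem cnt_coreWith : ∀ j S, cnt (coreWith S j) =
    3 ^ (j + 1) + ((S 0).toNat + (S 1).toNat + (S 2).toNat)
  | 0 => by decide +kernel
  | j + 1 => by
    intro S
    rw [cnt_eq_sum (a := 0) (b := 1) (k := 2) (by decide) (by decide) (by decide)]
    simp only [sub_coreWith, cnt_coreWith j]
    simp [pow_succ]
    ring

theorem exists_mv_cnt_eq : ∀ j, ∃ X : WordSet (j + 2), MV X ∧ cnt X = 3 ^ j + 3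
  -- The words `00`, `01`, `21`, `22`: the core needs three letters, so length two has its own
  -- example.
  | 0 => ⟨ofBools true true false false false false false true true, by decide +kernel,
      by decide +kernel⟩
  | j + 1 => ⟨coreWith (fun _ => true) j, (coreWith_visible j).1 _, by rw [cnt_coreWith]; rfl⟩

end WordSet

-- Transfer to the Sierpiński graph

/-- Nested words as functions on positions. -/
def wordEquiv : ∀ n, Word n ≃ (Fin n → Fin 3)
  | 0 => Equiv.ofUnique Unit _
  | n + 1 => ((Equiv.refl (Fin 3)).prodCongr (wordEquiv n)).trans (Fin.consEquiv fun _ => Fin 3)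

theorem wordEquiv_cons {n : ℕ} (a : Fin 3) (u : Word n) :
    wordEquiv (n + 1) (a, u) = (Fin.cons a (wordEquiv n u) : Fin (n + 1) → Fin 3) := rfl

theorem wordEquiv_corner (c : Fin 3) : ∀ n, wordEquiv n (Word.corner c n) = fun _ => c
  | 0 => Subsingleton.elim _ _
  | n + 1 => by
    rw [Word.corner, wordEquiv_cons, wordEquiv_corner c n]
    funext i
    refine Fin.cases ?_ (fun i => ?_) i <;> simp

theorem wordEquiv_eq_const {n : ℕ} {c : Fin 3} {u : Word n} :
    (∀ i, wordEquiv n u i = c) ↔ u = Word.corner c n := by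
  rw [← (wordEquiv n).injective.eq_iff, wordEquiv_corner, funext_iff]

theorem sierpinskiGraph_adj_wordEquiv : ∀ {n} {u v : Word n},
    (sierpinskiGraph 3 n).Adj (wordEquiv n u) (wordEquiv n v) ↔ (wordGraph n).Adj u v
  | 0, _, _ => ⟨fun ⟨h, _⟩ => h.elim0, fun h => h.elim⟩
  | n + 1, (a, u), (b, v) => by
    have ih := sierpinskiGraph_adj_wordEquiv (u := u) (v := v)
    have h1 : (wordGraph (n + 1)).Adj (a, u) (b, v) ↔ (a = b ∧ (wordGraph n).Adj u v) ∨
      (a ≠ b ∧ u = Word.corner b n ∧ v = Word.corner a n) := Iff.rfl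
    rw [h1, ← ih, ← wordEquiv_eq_const, ← wordEquiv_eq_const, wordEquiv_cons, wordEquiv_cons]
    simp only [sierpinskiGraph, Fin.exists_fin_succ, Fin.forall_fin_succ, Fin.cons_zero,
      Fin.cons_succ, Fin.succ_lt_succ_iff, Fin.succ_pos, Fin.not_lt_zero, forall_true_left,
      IsEmpty.forall_iff, true_and, lt_self_iff_false, forall_and]
    -- The position `h` is either the first one, giving an edge between copies, or a later one,
    -- giving an edge inside a copy.
    constructor
    · rintro (h | ⟨i, h⟩)
      · exact Or.inr h.2
      · exact Or.inl ⟨h.1.1, i, h.1.2, h.2⟩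
    · rintro (⟨h, i, h'⟩ | h)
      · exact Or.inr ⟨i, ⟨h, h'.1⟩, h'.2⟩
      · exact Or.inl ⟨fun _ => trivial, h⟩

/-- The isomorphism between the two models of the Sierpiński graph. -/
def wordIso (n : ℕ) : wordGraph n ≃g sierpinskiGraph 3 n where
  toEquiv := wordEquiv n
  map_rel_iff' := sierpinskiGraph_adj_wordEquiv

theorem SimpleGraph.Iso.exists_walk {V W : Type*} {G : SimpleGraph V} {H : SimpleGraph W}
    (e : G ≃g H) {u v : V} (p : H.Walk (e u) (e v)) :
    ∃ q : G.Walk u v, q.length = p.length ∧ ∀ w ∈ q.support, e w ∈ p.support := by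
  refine ⟨(p.map e.symm.toHom).copy (e.symm_apply_apply u) (e.symm_apply_apply v), ?_,
    fun w hw => ?_⟩
  · rw [SimpleGraph.Walk.length_copy]
    exact SimpleGraph.Walk.length_map _ p
  · rw [SimpleGraph.Walk.support_copy, SimpleGraph.Walk.support_map, List.mem_map] at hw
    obtain ⟨z, hz, rfl⟩ := hw
    exact (e.apply_symm_apply z).symm ▸ hz

theorem dist_wordIso {n : ℕ} (u v : Word n) :
    (sierpinskiGraph 3 n).dist (wordIso n u) (wordIso n v) = WordSet.wordDist u v := by
  obtain ⟨p, hp, -⟩ := WordSet.exists_walk_of_vis (WordSet.vis_empty u v)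
  have p' : (sierpinskiGraph 3 n).Walk (wordIso n u) (wordIso n v) := p.map (wordIso n).toHom
  refine le_antisymm ?_ ?_
  · rw [← hp, ← SimpleGraph.Walk.length_map (wordIso n).toHom p]
    exact SimpleGraph.dist_le _
  · obtain ⟨q, hq⟩ := p'.reachable.exists_walk_length_eq_dist
    obtain ⟨r, hr, -⟩ := (wordIso n).exists_walk q
    rw [← hq, ← hr]
    exact WordSet.wordDist_le r

namespace WordSet

variable {n : ℕ}

/-- A finite set of vertices as a set of nested words. -/
def ofFinset (X : Finset (Fin n → Fin 3)) : WordSet n := fun u => decide (wordEquiv n u ∈ X)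

theorem ofFinset_iff {X : Finset (Fin n → Fin 3)} {u : Word n} :
    ofFinset X u = true ↔ wordIso n u ∈ X := decide_eq_true_iff

theorem xVisible_iff {X : Finset (Fin n → Fin 3)} {u v : Word n} :
    (sierpinskiGraph 3 n).XVisible X (wordIso n u) (wordIso n v) ↔ Vis (ofFinset X) u v := by
  constructor
  · rintro ⟨p, -, hp, hX⟩
    obtain ⟨q, hq, hqs⟩ := (wordIso n).exists_walk p
    refine vis_of_walk q (by rw [hq, hp, dist_wordIso]) fun w hw hwX => ?_
    exact (hX ⟨hqs w hw, ofFinset_iff.1 hwX⟩).imp (fun h => (wordIso n).injective h)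
      fun h => (wordIso n).injective h
  · intro h
    obtain ⟨q, hq, hqs⟩ := exists_walk_of_vis h
    have hl : (q.map (wordIso n).toHom).length =
        (sierpinskiGraph 3 n).dist (wordIso n u) (wordIso n v) := by
      rw [dist_wordIso, SimpleGraph.Walk.length_map, hq]
    refine ⟨q.map (wordIso n).toHom, SimpleGraph.Walk.isPath_of_length_eq_dist _ hl, hl, ?_⟩
    rintro _ ⟨hw, hwX⟩
    rw [Set.mem_ofPred_eq, SimpleGraph.Walk.support_map, List.mem_map] at hw
    obtain ⟨z, hz, rfl⟩ := hw
    exact (hqs z hz (ofFinset_iff.2 hwX)).imp (fun h => by rw [h]; rfl) fun h => by rw [h]; rfl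

theorem isMutualVisibilitySet_iff {X : Finset (Fin n → Fin 3)} :
    (sierpinskiGraph 3 n).IsMutualVisibilitySet X ↔ MV (ofFinset X) := by
  constructor
  · exact fun h u v hu hv => xVisible_iff.1 (h _ (ofFinset_iff.1 hu) _ (ofFinset_iff.1 hv))
  · intro h u hu v hv
    obtain ⟨u, rfl⟩ := (wordIso n).surjective u
    obtain ⟨v, rfl⟩ := (wordIso n).surjective v
    exact xVisible_iff.2 (h u v (ofFinset_iff.2 hu) (ofFinset_iff.2 hv))

theorem cnt_eq_sum_toNat : ∀ {n} (X : WordSet n), cnt X = ∑ u, (X u).toNat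
  | 0, X => by simp [cnt]
  | n + 1, X => by
    have h : ∑ u : Word (n + 1), (X u).toNat = ∑ u : Fin 3 × Word n, (X u).toNat := rfl
    rw [h, Fintype.sum_prod_type, Fin.sum_univ_three, cnt, cnt_eq_sum_toNat, cnt_eq_sum_toNat,
      cnt_eq_sum_toNat]
    rfl

theorem cnt_ofFinset (X : Finset (Fin n → Fin 3)) : cnt (ofFinset X) = X.card := by
  have h : ∀ u : Word n, (ofFinset X u).toNat =
      (fun f => if f ∈ X then 1 else 0 : (Fin n → Fin 3) → ℕ) (wordEquiv n u) := fun u => by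
    by_cases hu : wordEquiv n u ∈ X <;> simp [ofFinset, hu]
  rw [cnt_eq_sum_toNat, Finset.sum_congr rfl fun u _ => h u,
    Equiv.sum_comp (wordEquiv n) (fun f => if f ∈ X then 1 else 0)]
  simp

theorem cnt_sub_ofFinset (X : Finset (Fin (n + 1) → Fin 3)) (a : Fin 3) :
    cnt (sub (ofFinset X) a) = (X ∩ sierpinskiCopy 3 (n + 1) a).card := by
  have h : ∀ b, sub (ofFinset (X ∩ sierpinskiCopy 3 (n + 1) a)) b =
      fun u => sub (ofFinset X) b u && decide (b = a) := by
    intro b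
    funext u
    have : wordEquiv (n + 1) (b, u) ∈ sierpinskiCopy 3 (n + 1) a ↔ b = a := by
      rw [wordEquiv_cons]
      simp [sierpinskiCopy]
    simp [sub, ofFinset, this]
  obtain ⟨b, hba⟩ := exists_ne a
  obtain ⟨k, hka, hkb⟩ := exists_third hba.symm
  rw [← cnt_ofFinset, cnt_eq_sum hba.symm hka hkb, h, h, h,
    cnt_eq_zero (X := fun u => sub (ofFinset X) b u && decide (b = a)) (by simp [hba]),
    cnt_eq_zero (X := fun u => sub (ofFinset X) k u && decide (k = a)) (by simp [hka])]
  simp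

theorem exists_ofFinset_eq (Y : WordSet n) : ∃ X, ofFinset X = Y :=
  ⟨Finset.univ.filter fun f => Y ((wordEquiv n).symm f) = true, by
    funext u
    simp [ofFinset]⟩

/-- Attainment and boundedness together determine the `sSup` defining the mutual-visibility number.
-/
theorem isGreatest_card (j : ℕ) : IsGreatest {k | ∃ X : Finset (Fin (j + 2) → Fin 3),
    (sierpinskiGraph 3 (j + 2)).IsMutualVisibilitySet X ∧ X.card = k} (3 ^ j + 3) := by
  constructor
  · obtain ⟨Y, hY, hc⟩ := exists_mv_cnt_eq j
    obtain ⟨X, rfl⟩ := exists_ofFinset_eq Y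
    exact ⟨X, isMutualVisibilitySet_iff.2 hY, by rw [← cnt_ofFinset, hc]⟩
  · rintro _ ⟨X, hX, rfl⟩
    rw [← cnt_ofFinset]
    exact cnt_le _ (isMutualVisibilitySet_iff.1 hX)

theorem card_inter_union_le {j : ℕ} {X : Finset (Fin (j + 1 + 2) → Fin 3)}
    (hX : (sierpinskiGraph 3 (j + 1 + 2)).IsMutualVisibilitySet X) (a b : Fin 3) :
    (X ∩ (sierpinskiCopy 3 (j + 1 + 2) a ∪ sierpinskiCopy 3 (j + 1 + 2) b)).card ≤
      2 * 3 ^ j + 4 := by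
  have hM := isMutualVisibilitySet_iff.1 hX
  by_cases hab : a = b
  · subst hab
    rw [Finset.union_self, ← cnt_sub_ofFinset]
    have := cnt_le _ (mv_sub hM a)
    have : 0 < 3 ^ j := by positivity
    omega
  · rw [Finset.inter_union_distrib_left]
    refine (Finset.card_union_le _ _).trans ?_
    rw [← cnt_sub_ofFinset, ← cnt_sub_ofFinset]
    exact cnt_sub_add_le _ hM hab

end WordSet

theorem mutualVisibilityNumber_sierpinskiGraph (j : ℕ) :
    (sierpinskiGraph 3 (j + 2)).mutualVisibilityNumber = 3 ^ j + 3 :=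
  (WordSet.isGreatest_card j).csSup_eq

theorem mainTheorem1 (n : ℕ) (hn : 2 ≤ n) :
    (sierpinskiGraph 3 n).mutualVisibilityNumber = 3 ^ (n - 2) + 3 ∧
    (4 ≤ n → ∀ X : Finset (Fin n → Fin 3), (sierpinskiGraph 3 n).IsMuSet X →
      ∀ i : Fin 3, (X ∩ sierpinskiCopy 3 n i).card = 3 ^ (n - 3) + 1) ∧
    (4 ≤ n → ∀ X : Finset (Fin n → Fin 3), (sierpinskiGraph 3 n).IsMutualVisibilitySet X →
      ∀ i j : Fin 3,
        (X ∩ (sierpinskiCopy 3 n i ∪ sierpinskiCopy 3 n j)).card ≤ 2 * 3 ^ (n - 3) + 4) := by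
  obtain ⟨m, rfl⟩ := Nat.exists_eq_add_of_le' hn
  refine ⟨mutualVisibilityNumber_sierpinskiGraph m, fun h4 X hX i => ?_, fun h4 X hX i j => ?_⟩
  · obtain ⟨j, rfl⟩ : ∃ j, m = j + 1 := ⟨m - 1, by omega⟩
    rw [← WordSet.cnt_sub_ofFinset, WordSet.cnt_sub_eq (by omega) _
      (WordSet.isMutualVisibilitySet_iff.1 hX.1)]
    · rfl
    · rw [WordSet.cnt_ofFinset, hX.2, mutualVisibilityNumber_sierpinskiGraph]
  · obtain ⟨l, rfl⟩ : ∃ l, m = l + 1 := ⟨m - 1, by omega⟩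
    exact WordSet.card_inter_union_le hX i j
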